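/- Let $n\ge 0$ and let $P=\bigoplus_{i=1}^n\mathbb Z\,\varepsilon_i$, acted on by $W=S_n\ltimes(\mathbb Z/2)^n$ through permutations and sign changes of the $\varepsilon_i$. Let $R=\{\pm\varepsilon_i\pm\varepsilon_j\ (i\ne j)\}\cup\{\pm\varepsilon_i\}$ be the root system of $\mathfrak{o}(2n+1)$, with parity $p(\pm\varepsilon_i\pm\varepsilon_j)=0$ and $p(\pm\varepsilon_i)=1$ (that is, $\pm\varepsilon_i\pm\varepsilon_j$ are even roots and $\pm\varepsilon_i$ the odd roots of $\mathfrak{osp}(1|2n)$), and let $R^+=\{\varepsilon_i-\varepsilon_j,\ \varepsilon_i+\varepsilon_j\ (i<j)\}\cup\{\varepsilon_i\}$. Let $P^+$ be the set of dominant weights $\lambda=\sum\lambda_i\varepsilon_i\in P$, $\lambda_1\ge\dots\ge\lambda_n\ge 0$; write $\mu<\lambda$ if $\mu\neq\lambda$ and $\lambda-\mu$ is a sum of elements of $R^+$. For a field $K\supseteq\mathbb C$ let $A=K[P]$ be the group algebra, with basis $e^\lambda$ $(\lambda\in P)$, let $A^W$ be its subspace of $W$-invariants, let $m_\lambda=\sum_{\nu\in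 W\lambda}e^\nu$, let $f\mapsto\bar f$ be the $K$-linear map with $\overline{e^\lambda}=e^{-\lambda}$, and let $[f]_0$ be the coefficient of $e^0$ in $f$. For $q,\epsilon\in K$ with $\epsilon^2=1$ and an integer $k\ge 0$ put $t=q^k$ and $$\Delta=\prod_{\alpha\in R}\ \prod_{r=0}^{k-1}\bigl(1-\epsilon^{p(\alpha)}q^re^\alpha\bigr),\qquad (f,g)=[f\,\bar g\,\Delta]_0\quad(f,g\in A).$$ Assume that $q$ is an indeterminate (more generally, an element of $K$ transcendental over $\mathbb Q$) or a real number with $0<q<1$. **Theorem 4.2.** There are rational functions $u_{\lambda,\mu}(q,t,\epsilon)$ with rational coefficients ($\lambda,\mu\in P^+$, $\mu<\lambda$), depending only on $n,\lambda,\mu$, such that for all $K,q,\epsilon,k$ as above they have a denominator that does not vanish at $(q,q^k,\epsilon)$, and the elements $$F_\lambda=m_\lambda+\sum_{\mu<\lambda}u_{\lambda,\mu}(q,q^k,\epsilon)\,m_\mu\qquad(\lambda\in P^+)$$ form a basis of $A^W$ with $(F_\lambda,F_\mu)=0$ whenever $\lambda\ne\mu$. This basis is unique up to constant factors: if $G_\lambda=c_\lambda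 m_\lambda+\sum_{\mu<\lambda}v_{\lambda,\mu}m_\mu$ $(\lambda\in P^+)$ with $c_\lambda,v_{\lambda,\mu}\in K$, $c_\lambda\ne0$, and $(G_\lambda,G_\mu)=0$ whenever $\lambda\neq\mu$, then $G_\lambda=C_\lambda F_\lambda$ with $C_\lambda\in K\setminus\{0\}$ for every $\lambda\in P^+$. -/

import Mathlib

noncomputable section

namespace OrthoB

/-- The weight lattice `P`: the vector `v` stands for the weight `∑ i, v i • ε_i`. -/
abbrev Weight (n : ℕ) := Fin n → ℤ

/-- The weight `ε_i`. -/
def eps {n : ℕ} (i : Fin n) : Weight n := Pi.single i 1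

/-- The roots `± ε_i ± ε_j` with `i ≠ j` (each of them counted once). -/
def evenRoots (n : ℕ) : Finset (Weight n) :=
  ((Finset.univ : Finset ((Fin n × Fin n) × (ℤˣ × ℤˣ))).filter fun x => x.1.1 ≠ x.1.2).image
    fun x => (x.2.1 : ℤ) • eps x.1.1 + (x.2.2 : ℤ) • eps x.1.2

/-- The roots `± ε_i`. -/
def oddRoots (n : ℕ) : Finset (Weight n) :=
  (Finset.univ : Finset (Fin n × ℤˣ)).image fun x => (x.2 : ℤ) • eps x.1

/-- The root system of `o(2n+1)`. -/
def roots (n : ℕ) : Finset (Weight n) := evenRoots n ∪ oddRoots n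

/-- The parity of a root: `1` on the roots `± ε_i` and `0` on the roots `± ε_i ± ε_j`. -/
def parity {n : ℕ} (a : Weight n) : ℕ := if a ∈ oddRoots n then 1 else 0

/-- The positive roots `ε_i - ε_j`, `ε_i + ε_j` (`i < j`) and `ε_i`. -/
def positiveRoots (n : ℕ) : Set (Weight n) :=
  {a | (∃ i j, i < j ∧ (a = eps i - eps j ∨ a = eps i + eps j)) ∨ ∃ i, a = eps i}

/-- The dominance order on weights: `mu ≤ lam` if `lam - mu` is a sum of positive roots. -/
def DomLE {n : ℕ} (mu lam : Weight n) : Prop :=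
  lam - mu ∈ AddSubmonoid.closure (positiveRoots n)

/-- The dominant weights in `P`: those with `v_1 ≥ v_2 ≥ ... ≥ v_n ≥ 0`. -/
abbrev DominantWeight (n : ℕ) := {v : Weight n // Antitone v ∧ ∀ i, 0 ≤ v i}

theorem finite_below {n : ℕ} (lam : DominantWeight n) :
    {mu : DominantWeight n | mu ≠ lam ∧ DomLE mu.1 lam.1}.Finite := by
  have key : ∀ x ∈ AddSubmonoid.closure (positiveRoots n), 0 ≤ ∑ i, x i := by
    intro x hx
    induction hx using AddSubmonoid.closure_induction with
    | mem x hx =>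
      rcases hx with ⟨i, j, -, rfl | rfl⟩ | ⟨i, rfl⟩ <;>
        simp [eps, Finset.sum_add_distrib, Finset.sum_sub_distrib]
    | zero => simp
    | add x y _ _ hx hy =>
      simp only [Pi.add_apply, Finset.sum_add_distrib]
      exact add_nonneg hx hy
  refine Set.Finite.subset (Set.Finite.preimage Subtype.val_injective.injOn
    (Set.finite_Icc (0 : Weight n) (fun _ => ∑ i, lam.1 i))) ?_
  rintro mu ⟨-, h⟩
  have h1 := key _ h
  simp only [Pi.sub_apply, Finset.sum_sub_distrib] at h1
  refine ⟨fun i => mu.2.2 i, fun i => ?_⟩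
  have h2 := Finset.single_le_sum (fun j _ => mu.2.2 j) (Finset.mem_univ i)
  linarith

/-- The finite set of the dominant weights `mu < lam`. -/
def below {n : ℕ} (lam : DominantWeight n) : Finset (DominantWeight n) :=
  (finite_below lam).toFinset

/-- The action on `P` of the element of the Weyl group `W = S_n ⋉ (ℤ/2)^n` given by a permutation
`σ` of the `ε_i` and a vector `s` of sign changes: `ε_i ↦ s (σ i) • ε_(σ i)`. -/
def weylAct {n : ℕ} (σ : Equiv.Perm (Fin n)) (s : Fin n → ℤˣ) : Weight n ≃+ Weight n where
  toFun v := fun i => (s i : ℤ) * v (σ.symm i)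
  invFun v := fun i => (s (σ i) : ℤ) * v (σ i)
  left_inv v := by
    funext i
    rcases Int.units_eq_one_or (s (σ i)) with h | h <;> simp [h]
  right_inv v := by
    funext i
    rcases Int.units_eq_one_or (s i) with h | h <;> simp [h]
  map_add' v w := by
    funext i
    simp [mul_add]

/-- The `W`-orbit of a weight. -/
def orbit {n : ℕ} (v : Weight n) : Finset (Weight n) :=
  (Finset.univ : Finset (Equiv.Perm (Fin n) × (Fin n → ℤˣ))).image fun w => weylAct w.1 w.2 v

section Algebra

variable (K : Type*) [Field K] (n : ℕ)

/-- The group algebra `A = K[P]`. -/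
abbrev GroupAlg := AddMonoidAlgebra K (Weight n)

/-- The subspace `A^W` of `W`-invariant elements of `A`. -/
def invariants : Submodule K (GroupAlg K n) where
  carrier := {f | ∀ σ s, AddMonoidAlgebra.domCongr K K (weylAct σ s) f = f}
  zero_mem' := fun _ _ => map_zero _
  add_mem' := fun {f g} hf hg σ s => by rw [map_add, hf σ s, hg σ s]
  smul_mem' := fun c f hf σ s => by rw [map_smul, hf σ s]

variable {n}

/-- The formal exponential `e^v`. -/
def expo (v : Weight n) : GroupAlg K n := AddMonoidAlgebra.single v 1

/-- The orbit sum `m_lam`, the sum of `e^v` over the `v` in the `W`-orbit of `lam`. -/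
def orbitSum (lam : DominantWeight n) : GroupAlg K n := ∑ v ∈ orbit lam.1, expo K v

variable {K}

/-- The `K`-linear involution of `A` with `e^v ↦ e^(-v)`. -/
def conj (f : GroupAlg K n) : GroupAlg K n :=
  AddMonoidAlgebra.domCongr K K (AddEquiv.neg (Weight n)) f

/-- The constant term of an element of `A`. -/
def constTerm (f : GroupAlg K n) : K := f.coeff 0

variable (n) in
/-- The weight function `Δ(q, t, ε)` for `t = q ^ k`. -/
def weightFn (q ε : K) (k : ℕ) : GroupAlg K n :=
  ∏ a ∈ roots n, ∏ r ∈ Finset.range k, (1 - (ε ^ parity a * q ^ r) • expo K a)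

/-- The pairing `(f, g) = [f ḡ Δ]_0`. -/
def pairing (q ε : K) (k : ℕ) (f g : GroupAlg K n) : K :=
  constTerm (f * conj g * weightFn n q ε k)

/-- The values of `q` that are considered: `q` is an indeterminate (more generally, any element
that is transcendental over the prime field), or a real number with `0 < q < 1`. -/
def Admissible [Algebra ℂ K] (q : K) : Prop :=
  Transcendental ℤ q ∨ ∃ x : ℝ, 0 < x ∧ x < 1 ∧ q = algebraMap ℂ K (x : ℂ)

/-- The value at `(q, q ^ k, ε)` of a polynomial in three variables that stand, in this order,
for `q`, `t` and `ε`. -/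
def evalQT (q ε : K) (k : ℕ) (p : MvPolynomial (Fin 3) ℤ) : K :=
  MvPolynomial.aeval ![q, q ^ k, ε] p

end Algebra

end OrthoB

end

/-! The proof is Macdonald's: a self-adjoint triangular operator with separated eigenvalues. Every
root pairs to `-1`, `0` or `1` with the coweights `±ε_i`, so these are minuscule and give a
`q`-difference operator `D = ∑ A_{i,s} T_{i,s}`. Here `T_{i,s} e^v = q^(s v_i) e^v`, and `A_{i,s}`
is the product of `(1 - ε^p(α) t e^α) / (1 - ε^p(α) e^α)` over the roots with `s α_i = 1`. The
constant term is `T`-invariant and `T_{i,-s}` carries `A_{i,s} Δ` to `A_{i,-s} Δ`, so `D` is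
self-adjoint and its eigenvectors for different eigenvalues are orthogonal.

Fractions are avoided by multiplying `D` by the Weyl denominator of `sp(2n)`, whose factor `x - x⁻¹`
is divisible by `1 - εx` for both signs `ε`. The eigenvector equation then compares antisymmetric
Laurent polynomials. Such a polynomial vanishes once its coefficients at the weights `mu + ρ` do
(`eq_zero_of_antisymmetric`), which leaves a finite triangular linear system for the coefficients of
the eigenvector.

Three facts about rational functions carry the rest. For `mu < lam` the eigenvalues differ at every
real `0 < q < 1` (`eigenvalue_lt`, by convexity), so the system is solvable over the rational
functions regular at all points `(x, x^k, ±1)`; this gives the universal coefficients. Incomparable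
weights can have equal eigenvalues at a particular real `q`, so orthogonality is proved for
indeterminate `q`, where all dominant weights are separated (`eigenvalue_ne`), and then specialized.
Finally `(f, f)` is a sum of squares at real `q` (`pair_self_pos`), so the norms are units among the
rational functions regular on `0 < q < 1`. They stay nonzero in every `K`, although the pairing is
bilinear and positivity has no meaning there. Nonzero norms give independence and uniqueness. -/

noncomputable section

namespace OrthoB

/-! ### The dominance order -/

section Weights

variable {n : ℕ}

/-- The sum of the first `k` coordinates of a weight. -/
def partialSum (k : ℕ) : Weight n →+ ℤ where
  toFun v := ∑ i : Fin n, if (i : ℕ) < k then v i else 0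
  map_zero' := by simp
  map_add' v w := by
    rw [← Finset.sum_add_distrib]
    exact Finset.sum_congr rfl fun i _ => by split_ifs <;> simp

theorem partialSum_apply (k : ℕ) (v : Weight n) :
    partialSum k v = ∑ i : Fin n, if (i : ℕ) < k then v i else 0 := rfl

theorem partialSum_eps (k : ℕ) (j : Fin n) :
    partialSum k (eps j) = if (j : ℕ) < k then 1 else 0 := by
  rw [partialSum_apply, Finset.sum_eq_single j]
  · simp [eps]
  · intro i _ hi
    simp [eps, hi]
  · simp

theorem partialSum_succ (j : Fin n) (v : Weight n) :
    partialSum ((j : ℕ) + 1) v = partialSum (j : ℕ) v + v j := by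
  have h : v j = ∑ i : Fin n, if i = j then v i else 0 := by simp
  rw [h, partialSum_apply, partialSum_apply, ← Finset.sum_add_distrib]
  refine Finset.sum_congr rfl fun i _ => ?_
  by_cases hij : i = j
  · subst hij; simp
  · have : (i : ℕ) ≠ j := fun h => hij (Fin.ext h)
    rw [if_neg hij, add_zero]
    exact if_congr (by omega) rfl rfl

/-- The simple roots of `o(2n+1)`. -/
def simpleRoot (k : Fin n) : Weight n :=
  eps k - if h : (k : ℕ) + 1 < n then eps ⟨k + 1, h⟩ else 0

theorem simpleRoot_mem (k : Fin n) : simpleRoot k ∈ positiveRoots n := by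
  unfold simpleRoot
  split_ifs with h
  · exact Or.inl ⟨k, ⟨k + 1, h⟩, by simp [Fin.lt_def], Or.inl rfl⟩
  · exact Or.inr ⟨k, by simp⟩

theorem eq_sum_simpleRoot (v : Weight n) :
    v = ∑ k : Fin n, partialSum ((k : ℕ) + 1) v • simpleRoot k := by
  funext j
  have h2 : ∀ k : Fin n, (simpleRoot k) j =
      (if k = j then 1 else 0) - (if (k : ℕ) + 1 = j then 1 else 0) := by
    intro k
    unfold simpleRoot
    rw [Pi.sub_apply]
    congr 1
    · simp [eps, Pi.single_apply, eq_comm]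
    · split_ifs with h h' h'
      · have : j = ⟨k + 1, h⟩ := Fin.ext h'.symm
        simp [eps, this]
      · have : j ≠ ⟨k + 1, h⟩ := fun h => h' (by simp [h])
        simp [eps, this]
      · have := j.2; omega
      · rfl
  have h1 : ∀ k : Fin n, (partialSum ((k : ℕ) + 1) v • simpleRoot k) j =
      (if k = j then partialSum ((j : ℕ) + 1) v else 0) -
        (if (k : ℕ) + 1 = j then partialSum (j : ℕ) v else 0) := by
    intro k
    rw [Pi.smul_apply, h2, smul_eq_mul, mul_sub, mul_ite, mul_ite, mul_one, mul_zero]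
    congr 1
    · split_ifs with h
      · rw [h]
      · rfl
    · split_ifs with h
      · rw [h]
      · rfl
  rw [Finset.sum_apply, Finset.sum_congr rfl fun k _ => h1 k, Finset.sum_sub_distrib,
    Finset.sum_ite_eq' Finset.univ j, if_pos (Finset.mem_univ j), partialSum_succ]
  have h3 : (∑ k : Fin n, if (k : ℕ) + 1 = j then partialSum (j : ℕ) v else 0) =
      partialSum (j : ℕ) v := by
    rcases Nat.eq_zero_or_pos (j : ℕ) with hj | hj
    · have : partialSum (j : ℕ) v = 0 := by simp [partialSum_apply, hj]
      simp [this]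
    · rw [Finset.sum_eq_single ⟨(j : ℕ) - 1, by omega⟩]
      · rw [if_pos]; simp; omega
      · intro k _ hk
        rw [if_neg]
        intro h
        exact hk (Fin.ext (by simp; omega))
      · simp
  rw [h3]; ring

/-- The partial sums are the coordinates in the basis of simple roots (`eq_sum_simpleRoot`), and in
type B this is a basis of all of `P`, so no congruence condition appears. -/
theorem domLE_iff {mu lam : Weight n} :
    DomLE mu lam ↔ ∀ k, partialSum k mu ≤ partialSum k lam := by
  constructor
  · intro h k
    rw [← sub_nonneg, ← map_sub]
    unfold DomLE at h
    generalize lam - mu = x at h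
    induction h using AddSubmonoid.closure_induction with
    | mem x hx =>
      rcases hx with ⟨i, j, hij, rfl | rfl⟩ | ⟨i, rfl⟩
      · rw [map_sub, partialSum_eps, partialSum_eps]
        have : (i : ℕ) < j := hij
        split_ifs <;> omega
      · rw [map_add, partialSum_eps, partialSum_eps]
        split_ifs <;> simp
      · rw [partialSum_eps]
        split_ifs <;> simp
    | zero => simp
    | add x y _ _ hx hy =>
      rw [map_add]
      exact add_nonneg hx hy
  · intro h
    unfold DomLE
    rw [eq_sum_simpleRoot (lam - mu)]
    refine AddSubmonoid.sum_mem _ fun k _ => ?_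
    have h0 : 0 ≤ partialSum ((k : ℕ) + 1) (lam - mu) := by
      rw [map_sub, sub_nonneg]; exact h _
    obtain ⟨m, hm⟩ := Int.eq_ofNat_of_zero_le h0
    rw [hm, natCast_zsmul]
    exact AddSubmonoid.nsmul_mem _ (AddSubmonoid.subset_closure (simpleRoot_mem k)) m

theorem DomLE.refl (v : Weight n) : DomLE v v := domLE_iff.2 fun _ => le_rfl

theorem DomLE.trans {u v w : Weight n} (h₁ : DomLE u v) (h₂ : DomLE v w) : DomLE u w :=
  domLE_iff.2 fun k => (domLE_iff.1 h₁ k).trans (domLE_iff.1 h₂ k)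

theorem DomLE.antisymm {u v : Weight n} (h₁ : DomLE u v) (h₂ : DomLE v u) : u = v := by
  funext j
  have h : ∀ k, partialSum k u = partialSum k v := fun k =>
    le_antisymm (domLE_iff.1 h₁ k) (domLE_iff.1 h₂ k)
  have h1 := partialSum_succ j u
  rw [h, h, partialSum_succ] at h1
  exact (add_left_cancel h1).symm

theorem DomLE.add {u v u' v' : Weight n} (h₁ : DomLE u v) (h₂ : DomLE u' v') :
    DomLE (u + u') (v + v') :=
  domLE_iff.2 fun k => by
    rw [map_add, map_add]
    exact add_le_add (domLE_iff.1 h₁ k) (domLE_iff.1 h₂ k)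

theorem domLE_add_right_iff {u v w : Weight n} : DomLE (u + w) (v + w) ↔ DomLE u v := by
  unfold DomLE
  rw [add_sub_add_right_eq_sub]

/-- A linear functional that is positive on the positive roots. -/
def height : Weight n →+ ℤ where
  toFun v := ∑ i : Fin n, ((n : ℤ) - i) * v i
  map_zero' := by simp
  map_add' v w := by simp [mul_add, Finset.sum_add_distrib]

theorem height_apply (v : Weight n) : height v = ∑ i : Fin n, ((n : ℤ) - i) * v i := rfl

theorem height_eps (j : Fin n) : height (eps j) = (n : ℤ) - j := by
  simp [height_apply, eps, Pi.single_apply]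

theorem DomLE.height_lt {mu lam : Weight n} (h : DomLE mu lam) (hne : mu ≠ lam) :
    height mu < height lam := by
  have key : ∀ x ∈ AddSubmonoid.closure (positiveRoots n), x = 0 ∨ 0 < height x := by
    intro x hx
    induction hx using AddSubmonoid.closure_induction with
    | mem x hx =>
      right
      rcases hx with ⟨i, j, hij, rfl | rfl⟩ | ⟨i, rfl⟩
      · have : (i : ℕ) < j := hij
        rw [map_sub, height_eps, height_eps]; omega
      · rw [map_add, height_eps, height_eps]; omega
      · rw [height_eps]; omega
    | zero => simp
    | add x y _ _ hx hy =>
      rcases hx with rfl | hx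
      · simpa using hy
      · rcases hy with rfl | hy
        · simpa using Or.inr hx
        · right; rw [map_add]; exact add_pos hx hy
  rcases key _ h with h0 | h0
  · exact absurd (sub_eq_zero.1 h0).symm hne
  · rwa [map_sub, sub_pos] at h0

theorem mem_below {lam mu : DominantWeight n} :
    mu ∈ below lam ↔ mu ≠ lam ∧ DomLE mu.1 lam.1 := by
  simp [below]

theorem height_lt_of_mem_below {lam mu : DominantWeight n} (h : mu ∈ below lam) :
    height mu.1 < height lam.1 :=
  (mem_below.1 h).2.height_lt fun h' => (mem_below.1 h).1 (Subtype.ext h')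

theorem height_nonneg (lam : DominantWeight n) : 0 ≤ height lam.1 := by
  rw [height_apply]
  exact Finset.sum_nonneg fun i _ => mul_nonneg (by omega) (lam.2.2 i)

theorem mem_below_trans {lam mu nu : DominantWeight n} (h₁ : nu ∈ below mu) (h₂ : mu ∈ below lam) :
    nu ∈ below lam := by
  refine mem_below.2 ⟨?_, (mem_below.1 h₁).2.trans (mem_below.1 h₂).2⟩
  rintro rfl
  exact absurd ((height_lt_of_mem_below h₁).trans (height_lt_of_mem_below h₂)) (lt_irrefl _)

/-- Induction along the dominance order on the dominant weights. -/
theorem below_induction {p : DominantWeight n → Prop}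
    (h : ∀ lam, (∀ mu ∈ below lam, p mu) → p lam) (lam : DominantWeight n) : p lam := by
  induction hN : (height lam.1).toNat using Nat.strong_induction_on generalizing lam with
  | _ N ih =>
    refine h lam fun mu hmu => ih _ ?_ mu rfl
    have := height_lt_of_mem_below hmu
    have := height_nonneg mu
    omega

/-! ### The Weyl group -/

theorem weylAct_apply (σ : Equiv.Perm (Fin n)) (s : Fin n → ℤˣ) (v : Weight n) (i : Fin n) :
    weylAct σ s v i = (s i : ℤ) * v (σ.symm i) := rfl

theorem weylAct_smul_eps (σ : Equiv.Perm (Fin n)) (s : Fin n → ℤˣ) (i : Fin n) (a : ℤˣ) :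
    weylAct σ s ((a : ℤ) • eps i) = ((s (σ i) * a : ℤˣ) : ℤ) • eps (σ i) := by
  funext j
  rw [weylAct_apply]
  by_cases hj : j = σ i
  · subst hj; simp [eps]
  · have : σ.symm j ≠ i := fun h => hj (by simp [← h])
    simp [eps, hj, this]

theorem weylAct_one_one (v : Weight n) : weylAct 1 1 v = v := by
  funext i
  simp only [weylAct_apply, Pi.one_apply, Units.val_one, one_mul]
  rfl

theorem weylAct_weylAct (σ τ : Equiv.Perm (Fin n)) (s r : Fin n → ℤˣ) (v : Weight n) :
    weylAct σ s (weylAct τ r v) = weylAct (σ * τ) (fun i => s i * r (σ.symm i)) v := by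
  funext i
  simp [weylAct_apply, mul_assoc, Equiv.Perm.mul_def]

theorem weylAct_symm_apply (σ : Equiv.Perm (Fin n)) (s : Fin n → ℤˣ) (v : Weight n) :
    (weylAct σ s).symm v = weylAct σ⁻¹ (fun i => s (σ i)) v := by
  funext i
  rfl

theorem mem_orbit {v w : Weight n} : w ∈ orbit v ↔ ∃ σ s, weylAct σ s v = w := by
  simp [orbit]

theorem self_mem_orbit (v : Weight n) : v ∈ orbit v := mem_orbit.2 ⟨1, 1, weylAct_one_one v⟩

theorem weylAct_mem_orbit_iff (σ : Equiv.Perm (Fin n)) (s : Fin n → ℤˣ) {v w : Weight n} :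
    weylAct σ s w ∈ orbit v ↔ w ∈ orbit v := by
  constructor
  · intro h
    obtain ⟨τ, r, h⟩ := mem_orbit.1 h
    have h1 : w = (weylAct σ s).symm (weylAct τ r v) := by rw [h]; simp
    rw [h1, weylAct_symm_apply, weylAct_weylAct]
    exact mem_orbit.2 ⟨_, _, rfl⟩
  · intro h
    obtain ⟨τ, r, rfl⟩ := mem_orbit.1 h
    rw [weylAct_weylAct]
    exact mem_orbit.2 ⟨_, _, rfl⟩

/-- Rearrangement inequality against the decreasing indicator of the first `k` indices; sign changes
can only lower the nonnegative coordinates. -/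
theorem domLE_of_mem_orbit (lam : DominantWeight n) {v : Weight n} (hv : v ∈ orbit lam.1) :
    DomLE v lam.1 := by
  obtain ⟨σ, s, rfl⟩ := mem_orbit.1 hv
  rw [domLE_iff]
  intro k
  let g : Fin n → ℤ := fun i => if (i : ℕ) < k then 1 else 0
  have hg : Antitone g := by
    intro i j hij
    have : (i : ℕ) ≤ j := hij
    simp only [g]
    split_ifs <;> omega
  have h1 := (lam.2.1.monovary hg).sum_comp_perm_mul_le_sum_mul (σ := σ.symm)
  have h2 : ∀ w : Weight n, partialSum k w = ∑ i, w i * g i := fun w => by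
    simp [partialSum_apply, g]
  rw [h2, h2]
  refine le_trans (Finset.sum_le_sum fun i _ => ?_) h1
  refine mul_le_mul_of_nonneg_right ?_ (by simp only [g]; split_ifs <;> simp)
  have := lam.2.2 (σ.symm i)
  rw [weylAct_apply]
  rcases Int.units_eq_one_or (s i) with h | h <;> simp [h]
  linarith

theorem eq_of_mem_orbit {lam mu : DominantWeight n} (h : mu.1 ∈ orbit lam.1) : mu = lam := by
  refine Subtype.ext ((domLE_of_mem_orbit lam h).antisymm (domLE_of_mem_orbit mu ?_))
  obtain ⟨σ, s, h⟩ := mem_orbit.1 h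
  rw [← weylAct_mem_orbit_iff σ s, h]
  exact self_mem_orbit _

theorem exists_weylAct_dominant (v : Weight n) :
    ∃ σ s, Antitone (weylAct σ s v) ∧ ∀ i, 0 ≤ weylAct σ s v i := by
  let τ := Tuple.sort fun i => -|v i|
  have hτ : Monotone ((fun i => -|v i|) ∘ τ) := Tuple.monotone_sort _
  have h : ∀ i, weylAct τ⁻¹ (fun i => if 0 ≤ v (τ i) then 1 else -1) v i = |v (τ i)| := by
    intro i
    rw [weylAct_apply]
    change _ * v (τ i) = _
    split_ifs with h0
    · simp [abs_of_nonneg h0]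
    · simp [abs_of_neg (not_le.1 h0)]
  refine ⟨τ⁻¹, fun i => if 0 ≤ v (τ i) then 1 else -1, fun i j hij => ?_, fun i => ?_⟩
  · rw [h, h]
    simpa using hτ hij
  · rw [h]; positivity

end Weights

/-! ### Leading terms -/

/-- The Laurent polynomials over a commutative ring, as the group algebra of the weight lattice. -/
abbrev Laurent (S : Type*) [CommRing S] (n : ℕ) := AddMonoidAlgebra S (Weight n)

section Top

variable {S : Type*} [CommRing S] {n : ℕ}

/-- All the weights of `f` are `≤ a`, and `c` is the coefficient of `e^a` in `f`. -/
structure HasTop (f : Laurent S n) (a : Weight n) (c : S) : Prop where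
  le : ∀ v, f.coeff v ≠ 0 → DomLE v a
  coeff_top : f.coeff a = c

theorem HasTop.coeff_eq_zero {f : Laurent S n} {a : Weight n} {c : S} (h : HasTop f a c)
    {v : Weight n} (hv : ¬ DomLE v a) : f.coeff v = 0 :=
  not_not.1 fun h' => hv (h.le v h')

theorem HasTop.add {f g : Laurent S n} {a : Weight n} {c d : S} (hf : HasTop f a c)
    (hg : HasTop g a d) : HasTop (f + g) a (c + d) where
  le v hv := by
    by_contra h
    exact hv (by simp [hf.coeff_eq_zero h, hg.coeff_eq_zero h])
  coeff_top := by simp [hf.coeff_top, hg.coeff_top]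

theorem HasTop.smul {f : Laurent S n} {a : Weight n} {c : S} (hf : HasTop f a c) (r : S) :
    HasTop (r • f) a (r * c) where
  le v hv := by
    by_contra h
    exact hv (by simp [hf.coeff_eq_zero h])
  coeff_top := by simp [hf.coeff_top]

theorem HasTop.neg {f : Laurent S n} {a : Weight n} {c : S} (hf : HasTop f a c) :
    HasTop (-f) a (-c) := by
  simpa using hf.smul (-1)

theorem HasTop.sub {f g : Laurent S n} {a : Weight n} {c d : S} (hf : HasTop f a c)
    (hg : HasTop g a d) : HasTop (f - g) a (c - d) := by
  simpa [sub_eq_add_neg] using hf.add hg.neg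

theorem HasTop.sum {ι : Type*} {s : Finset ι} {f : ι → Laurent S n} {a : Weight n} {c : ι → S}
    (h : ∀ i ∈ s, HasTop (f i) a (c i)) : HasTop (∑ i ∈ s, f i) a (∑ i ∈ s, c i) := by
  classical
  induction s using Finset.induction_on with
  | empty => exact ⟨fun v hv => absurd (by simp) hv, by simp⟩
  | insert i s hi ih =>
    rw [Finset.sum_insert hi, Finset.sum_insert hi]
    exact (h i (by simp)).add (ih fun j hj => h j (by simp [hj]))

/-- Leading coefficients multiply because `u ≤ a`, `w ≤ b` and `u + w = a + b` force `u = a` and `w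
= b`. -/
theorem HasTop.mul {f g : Laurent S n} {a b : Weight n} {c d : S} (hf : HasTop f a c)
    (hg : HasTop g b d) : HasTop (f * g) (a + b) (c * d) where
  le v hv := by
    classical
    have h := AddMonoidAlgebra.support_coeff_mul_subset f g (Finsupp.mem_support_iff.2 hv)
    obtain ⟨u, hu, w, hw, rfl⟩ := Finset.mem_add.1 h
    exact (hf.le u (Finsupp.mem_support_iff.1 hu)).add (hg.le w (Finsupp.mem_support_iff.1 hw))
  coeff_top := by
    rw [AddMonoidAlgebra.coeff_mul_add_of_uniqueAdd, hf.coeff_top, hg.coeff_top]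
    intro u w hu hw h
    have hu' := hf.le u (Finsupp.mem_support_iff.1 hu)
    have hw' := hg.le w (Finsupp.mem_support_iff.1 hw)
    have h1 : DomLE a u := by
      refine domLE_iff.2 fun k => ?_
      have := congrArg (partialSum k) h
      rw [map_add, map_add] at this
      have := domLE_iff.1 hw' k
      linarith
    have h2 : u = a := hu'.antisymm h1
    subst h2
    exact ⟨rfl, add_left_cancel h⟩

theorem hasTop_one : HasTop (1 : Laurent S n) 0 1 where
  le v hv := by
    by_cases h : v = 0
    · subst h; exact DomLE.refl 0
    · exact absurd (by simp [AddMonoidAlgebra.one_def, Ne.symm h]) hv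
  coeff_top := by simp [AddMonoidAlgebra.one_def]

theorem HasTop.prod {ι : Type*} {s : Finset ι} {f : ι → Laurent S n} {a : ι → Weight n} {c : ι → S}
    (h : ∀ i ∈ s, HasTop (f i) (a i) (c i)) :
    HasTop (∏ i ∈ s, f i) (∑ i ∈ s, a i) (∏ i ∈ s, c i) := by
  classical
  induction s using Finset.induction_on with
  | empty => exact hasTop_one
  | insert i s hi ih =>
    rw [Finset.prod_insert hi, Finset.prod_insert hi, Finset.sum_insert hi]
    exact (h i (by simp)).mul (ih fun j hj => h j (by simp [hj]))

theorem hasTop_single (a : Weight n) (r : S) : HasTop (AddMonoidAlgebra.single a r) a r where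
  le v hv := by
    by_cases h : v = a
    · subst h; exact DomLE.refl v
    · exact absurd (by simp [Ne.symm h]) hv
  coeff_top := by simp

theorem hasTop_single_of_ne {a b : Weight n} (h : DomLE b a) (hne : b ≠ a) (r : S) :
    HasTop (AddMonoidAlgebra.single b r) a 0 where
  le v hv := by
    by_cases hv' : v = b
    · subst hv'; exact h
    · exact absurd (by simp [Ne.symm hv']) hv
  coeff_top := by simp [hne]

theorem HasTop.congr {f g : Laurent S n} {a b : Weight n} {c d : S} (h : HasTop f a c)
    (hfg : f = g) (hab : a = b) (hcd : c = d) : HasTop g b d := by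
  subst hfg hab hcd; exact h

end Top

/-! ### The variables and the deformed Weyl denominators -/

section Kernel

variable (S : Type*) [CommRing S] {n : ℕ}

/-- The variable `x_i` (for `s = 1`) or its inverse (for `s = -1`). -/
def xvar (i : Fin n) (s : ℤˣ) : Laurent S n := AddMonoidAlgebra.single ((s : ℤ) • eps i) 1

/-- The invariant variable `z_i = x_i + x_i⁻¹`. -/
def zvar (i : Fin n) : Laurent S n := xvar S i 1 + xvar S i (-1)

variable (n) in
/-- The Weyl denominator of `sp(2n)`. -/
def weylDenom : Laurent S n :=
  (∏ j, (xvar S j 1 - xvar S j (-1))) * ∏ j, ∏ l ∈ Finset.Ioi j, (zvar S j - zvar S l)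

/-- The orbit sum of a dominant weight. -/
def orbSum (lam : DominantWeight n) : Laurent S n :=
  ∑ v ∈ orbit lam.1, AddMonoidAlgebra.single v 1

variable {S}

/-- The factor of the deformed Weyl denominator for one variable. -/
def kernelFactor (t ε : S) (i : Fin n) (s : ℤˣ) (j : Fin n) : Laurent S n :=
  -- With `X = x_i^s` and `ε^2 = 1`, `X - X⁻¹ = -X⁻¹(1 - εX)(1 + εX)`. Cancelling `1 - εX` and
  -- multiplying by `1 - εtX` leaves `-X⁻¹(1 + εX)(1 - εtX)`, written here expanded; the scalar `s`
  -- accounts for passing from `x_i - x_i⁻¹` to `X - X⁻¹`.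
  if j = i then ((s : ℤ) : S) • ((ε ^ 2 * t) • xvar S i s - (ε * (1 - t)) • 1 - xvar S i (-s))
  else xvar S j 1 - xvar S j (-1)

/-- The factor of the deformed Weyl denominator for a pair of variables. -/
def kernelPairFactor (t : S) (i : Fin n) (s : ℤˣ) (j l : Fin n) : Laurent S n :=
  -- With `X = x_i^s` and `Y = x_l`, `(1 - tXY)(1 - tXY⁻¹) = X(X⁻¹ - t z_l + t²X)`, which is `X(z_i
  -- - z_l)` at `t = 1`. The second branch is the same deformation with the opposite sign, since `i`
  -- is then the second index.
  if j = i then xvar S i (-s) - t • zvar S l + t ^ 2 • xvar S i s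
  else if l = i then t • zvar S j - xvar S i (-s) - t ^ 2 • xvar S i s
  else zvar S j - zvar S l

/-- The product of the Weyl denominator with the coefficient of the `q`-shift in the direction
`s • ε_i` in the difference operator. -/
def kernel (t ε : S) (i : Fin n) (s : ℤˣ) : Laurent S n :=
  (∏ j, kernelFactor t ε i s j) * ∏ j, ∏ l ∈ Finset.Ioi j, kernelPairFactor t i s j l

/-- The `q`-shift in the direction `s • ε_i`. -/
def shift (q : Sˣ) (i : Fin n) (s : ℤˣ) : Laurent S n →ₐ[S] Laurent S n :=
  AddMonoidAlgebra.lift S (Laurent S n) (Weight n)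
    { toFun := fun v => AddMonoidAlgebra.single v.toAdd ((q ^ ((s : ℤ) * v.toAdd i) : Sˣ) : S)
      map_one' := by simp [AddMonoidAlgebra.one_def]
      map_mul' := fun v w => by
        simp [AddMonoidAlgebra.single_mul_single, mul_add, zpow_add] }

/-- The difference operator, multiplied by the Weyl denominator. -/
def diffOp (q : Sˣ) (t ε : S) : Laurent S n →ₗ[S] Laurent S n :=
  ∑ p : Fin n × ℤˣ, LinearMap.mulLeft S (kernel t ε p.1 p.2) ∘ₗ (shift q p.1 p.2).toLinearMap

theorem diffOp_apply (q : Sˣ) (t ε : S) (f : Laurent S n) :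
    diffOp q t ε f = ∑ p : Fin n × ℤˣ, kernel t ε p.1 p.2 * shift q p.1 p.2 f := by
  simp [diffOp]

/-- The leading coefficient of `kernel t ε i s`. -/
def kernelTop (t ε : S) (i : Fin n) (s : ℤˣ) : S :=
  -- For `s = 1` the variable `x_i` contributes `ε²t`, the `n - 1 - i` pairs with first index `i`
  -- contribute `t²` each, and the `i` pairs with second index `i` contribute `t` each. For `s = -1`
  -- only the last contribute.
  if s = 1 then ε ^ 2 * t ^ (2 * n - 1 - (i : ℕ)) else t ^ (i : ℕ)

/-- The eigenvalue of the difference operator that belongs to the weight `v`. -/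
def eigenvalue (q : Sˣ) (t ε : S) (v : Weight n) : S :=
  ∑ p : Fin n × ℤˣ, kernelTop t ε p.1 p.2 * ((q ^ ((p.2 : ℤ) * v p.1) : Sˣ) : S)

variable (n) in
/-- The half sum of the positive roots of `sp(2n)`. -/
def rho : Weight n := fun i => (n : ℤ) - i

theorem shift_single (q : Sˣ) (i : Fin n) (s : ℤˣ) (v : Weight n) (r : S) :
    shift q i s (AddMonoidAlgebra.single v r) =
      AddMonoidAlgebra.single v (((q ^ ((s : ℤ) * v i) : Sˣ) : S) * r) := by
  simp [shift, AddMonoidAlgebra.lift_single, mul_comm]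

theorem coeff_shift (q : Sˣ) (i : Fin n) (s : ℤˣ) (f : Laurent S n) (v : Weight n) :
    (shift q i s f).coeff v = ((q ^ ((s : ℤ) * v i) : Sˣ) : S) * f.coeff v := by
  induction f using AddMonoidAlgebra.induction_linear with
  | zero => simp
  | add f g hf hg => simp [hf, hg, mul_add]
  | single w r =>
    rw [shift_single]
    by_cases h : w = v
    · subst h; simp
    · simp [h]

theorem HasTop.shift {f : Laurent S n} {a : Weight n} {c : S} (h : HasTop f a c) (q : Sˣ)
    (i : Fin n) (s : ℤˣ) :
    HasTop (shift q i s f) a (((q ^ ((s : ℤ) * a i) : Sˣ) : S) * c) where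
  le v hv := by
    refine h.le v fun h0 => hv ?_
    rw [coeff_shift, h0, mul_zero]
  coeff_top := by rw [coeff_shift, h.coeff_top]

theorem coeff_orbSum (lam : DominantWeight n) (v : Weight n) :
    (orbSum S lam).coeff v = if v ∈ orbit lam.1 then 1 else 0 := by
  simp [orbSum, Finsupp.single_apply]

theorem hasTop_orbSum (lam : DominantWeight n) : HasTop (orbSum S lam) lam.1 1 where
  le v hv := by
    refine domLE_of_mem_orbit lam ?_
    by_contra h
    exact hv (by rw [coeff_orbSum, if_neg h])
  coeff_top := by rw [coeff_orbSum, if_pos (self_mem_orbit _)]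

theorem prod_pairs_eq {M : Type*} [CommMonoid M] (i : Fin n) (g h : Fin n → M) :
    ∏ j, ∏ l ∈ Finset.Ioi j, (if j = i then g l else if l = i then h j else 1) =
      (∏ l ∈ Finset.Ioi i, g l) * ∏ j ∈ Finset.Iio i, h j := by
  rw [← Finset.mul_prod_erase _ _ (Finset.mem_univ i)]
  congr 1
  · exact Finset.prod_congr rfl fun l _ => by simp
  · have h1 : ∀ j ∈ Finset.univ.erase i,
        (∏ l ∈ Finset.Ioi j, (if j = i then g l else if l = i then h j else 1)) =
          if j ∈ Finset.Iio i then h j else 1 := by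
      intro j hj
      rw [Finset.prod_congr rfl fun l _ => if_neg (Finset.ne_of_mem_erase hj),
        Finset.prod_ite_eq']
      exact if_congr (by simp) rfl rfl
    rw [Finset.prod_congr rfl h1, Finset.prod_ite_mem]
    refine Finset.prod_congr ?_ fun _ _ => rfl
    ext j
    simp only [Finset.mem_inter, Finset.mem_erase, Finset.mem_univ, Finset.mem_Iio]
    exact ⟨fun h => h.2, fun h => ⟨⟨h.ne, trivial⟩, h⟩⟩

theorem rho_eq : (∑ j : Fin n, eps j) + ∑ j : Fin n, ∑ _l ∈ Finset.Ioi j, eps j = rho n := by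
  funext i
  simp only [Pi.add_apply, Finset.sum_apply, eps, Pi.single_apply, rho]
  simp
  omega

theorem domLE_zero_eps (j : Fin n) : DomLE 0 (eps j) := by
  unfold DomLE
  rw [sub_zero]
  exact AddSubmonoid.subset_closure (Or.inr ⟨j, rfl⟩)

theorem domLE_neg_eps_eps (j : Fin n) : DomLE (-eps j) (eps j) := by
  refine DomLE.trans (v := 0) ?_ (domLE_zero_eps j)
  simpa [DomLE] using domLE_zero_eps j

theorem domLE_eps_eps {j l : Fin n} (h : j < l) : DomLE (eps l) (eps j) :=
  AddSubmonoid.subset_closure (Or.inl ⟨j, l, h, Or.inl rfl⟩)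

theorem eps_ne_neg_eps (i : Fin n) : -eps i ≠ eps i := fun h => by
  have := congrFun h i
  simp [eps] at this

theorem xvar_one (i : Fin n) : xvar S i 1 = AddMonoidAlgebra.single (eps i) 1 := by simp [xvar]

theorem xvar_neg_one (i : Fin n) : xvar S i (-1) = AddMonoidAlgebra.single (-eps i) 1 := by
  simp [xvar]

theorem hasTop_xvar_one (i : Fin n) : HasTop (xvar S i 1) (eps i) 1 := by
  rw [xvar_one]; exact hasTop_single _ _

theorem hasTop_xvar_neg_one (i : Fin n) : HasTop (xvar S i (-1)) (eps i) 0 := by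
  rw [xvar_neg_one]
  exact hasTop_single_of_ne (domLE_neg_eps_eps i) (eps_ne_neg_eps i) _

theorem hasTop_one_eps (i : Fin n) : HasTop (1 : Laurent S n) (eps i) 0 :=
  hasTop_single_of_ne (domLE_zero_eps i) (fun h => by simpa [eps] using congrFun h i) _

theorem hasTop_zvar (i : Fin n) : HasTop (zvar S i) (eps i) 1 := by
  simpa [zvar] using (hasTop_xvar_one (S := S) i).add (hasTop_xvar_neg_one i)

theorem hasTop_xvar_of_lt {j l : Fin n} (h : j < l) (s : ℤˣ) :
    HasTop (xvar S l s) (eps j) 0 := by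
  refine hasTop_single_of_ne ?_ (fun h' => ?_) _
  · rcases Int.units_eq_one_or s with rfl | rfl
    · simpa using domLE_eps_eps h
    · simpa using (domLE_neg_eps_eps l).trans (domLE_eps_eps h)
  · have := congrFun h' j
    simp [eps, h.ne] at this

theorem hasTop_zvar_of_lt {j l : Fin n} (h : j < l) : HasTop (zvar S l) (eps j) 0 := by
  simpa [zvar] using (hasTop_xvar_of_lt (S := S) h 1).add (hasTop_xvar_of_lt h (-1))

theorem hasTop_kernelFactor (t ε : S) (i : Fin n) (s : ℤˣ) (j : Fin n) :
    HasTop (kernelFactor t ε i s j) (eps j)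
      (if j = i then (if s = 1 then ε ^ 2 * t else 1) else 1) := by
  unfold kernelFactor
  split_ifs with h hs
  · subst h hs
    refine (((((hasTop_xvar_one j).smul _).sub ((hasTop_one_eps j).smul _)).sub
      (hasTop_xvar_neg_one j)).smul _).congr rfl rfl ?_
    simp
  · subst h
    obtain rfl : s = -1 := (Int.units_eq_one_or s).resolve_left hs
    rw [neg_neg]
    refine (((((hasTop_xvar_neg_one j).smul _).sub ((hasTop_one_eps j).smul _)).sub
      (hasTop_xvar_one j)).smul _).congr rfl rfl ?_
    simp
  · simpa using (hasTop_xvar_one (S := S) j).sub (hasTop_xvar_neg_one j)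

theorem hasTop_kernelPairFactor (t : S) (i : Fin n) (s : ℤˣ) {j l : Fin n} (hjl : j < l) :
    HasTop (kernelPairFactor t i s j l) (eps j)
      (if j = i then (if s = 1 then t ^ 2 else 1) else if l = i then t else 1) := by
  unfold kernelPairFactor
  split_ifs with h hs h'
  · subst h hs
    refine (((hasTop_xvar_neg_one j).sub ((hasTop_zvar_of_lt hjl).smul t)).add
      ((hasTop_xvar_one j).smul _)).congr rfl rfl ?_
    simp
  · subst h
    obtain rfl : s = -1 := (Int.units_eq_one_or s).resolve_left hs
    rw [neg_neg]
    refine (((hasTop_xvar_one j).sub ((hasTop_zvar_of_lt hjl).smul t)).add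
      ((hasTop_xvar_neg_one j).smul _)).congr rfl rfl ?_
    simp
  · subst h'
    refine ((((hasTop_zvar j).smul t).sub (hasTop_xvar_of_lt hjl _)).sub
      ((hasTop_xvar_of_lt hjl _).smul _)).congr rfl rfl ?_
    simp
  · simpa using (hasTop_zvar (S := S) j).sub (hasTop_zvar_of_lt hjl)

theorem hasTop_kernel (t ε : S) (i : Fin n) (s : ℤˣ) :
    HasTop (kernel t ε i s) (rho n) (kernelTop t ε i s) := by
  have h1 := HasTop.prod (s := Finset.univ) fun j _ => hasTop_kernelFactor t ε i s j
  have h2 := HasTop.prod (s := Finset.univ) fun j _ =>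
    HasTop.prod (s := Finset.Ioi j) fun l hl =>
      hasTop_kernelPairFactor t i s (Finset.mem_Ioi.1 hl)
  have h3 := h1.mul h2
  rw [rho_eq, ← kernel] at h3
  refine h3.congr rfl rfl ?_
  rw [Finset.prod_ite_eq' Finset.univ i, if_pos (Finset.mem_univ i),
    prod_pairs_eq i (fun _ => if s = 1 then t ^ 2 else 1) (fun _ => t)]
  simp only [Finset.prod_const, Fin.card_Ioi, Fin.card_Iio, kernelTop]
  have := i.2
  split_ifs with h
  · rw [← pow_mul, mul_assoc, ← pow_add, ← pow_succ']
    congr 2; omega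
  · simp

theorem hasTop_weylDenom : HasTop (weylDenom S n) (rho n) 1 := by
  have h1 (j : Fin n) : HasTop (xvar S j 1 - xvar S j (-1)) (eps j) 1 := by
    simpa using (hasTop_xvar_one (S := S) j).sub (hasTop_xvar_neg_one j)
  have h2 {j l : Fin n} (h : j < l) : HasTop (zvar S j - zvar S l) (eps j) 1 := by
    simpa using (hasTop_zvar (S := S) j).sub (hasTop_zvar_of_lt h)
  have h3 := HasTop.prod (s := Finset.univ) fun j _ => h1 j
  have h4 := HasTop.prod (s := Finset.univ) fun j _ =>
    HasTop.prod (s := Finset.Ioi j) fun l hl => h2 (Finset.mem_Ioi.1 hl)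
  have h5 := h3.mul h4
  rw [rho_eq, ← weylDenom] at h5
  simpa only [Finset.prod_const_one, mul_one] using h5

theorem HasTop.diffOp {f : Laurent S n} {a : Weight n} (h : HasTop f a 1) (q : Sˣ) (t ε : S) :
    HasTop (diffOp q t ε f) (a + rho n) (eigenvalue q t ε a) := by
  rw [diffOp_apply]
  unfold eigenvalue
  refine HasTop.sum fun p _ => ?_
  have h1 := (hasTop_kernel t ε p.1 p.2).mul (h.shift q p.1 p.2)
  rwa [mul_one, add_comm] at h1

end Kernel

/-! ### Change of the base ring -/

section BaseChange

variable {S R : Type*} [CommRing S] [CommRing R] {n : ℕ} (φ : S →+* R)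

/-- The change of coefficients along a ring homomorphism. -/
abbrev baseChange : Laurent S n →+* Laurent R n := AddMonoidAlgebra.mapRingHom (Weight n) φ

theorem baseChange_smul (r : S) (f : Laurent S n) :
    baseChange φ (r • f) = φ r • baseChange φ f := by
  ext v; simp

theorem baseChange_xvar (i : Fin n) (s : ℤˣ) : baseChange φ (xvar S i s) = xvar R i s := by
  simp [xvar]

theorem baseChange_zvar (i : Fin n) : baseChange φ (zvar S i) = zvar R i := by
  simp only [zvar, map_add, baseChange_xvar]

theorem baseChange_weylDenom : baseChange φ (weylDenom S n) = weylDenom R n := by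
  simp only [weylDenom, map_mul, map_prod, map_sub, baseChange_xvar, baseChange_zvar]

theorem baseChange_orbSum (lam : DominantWeight n) :
    baseChange φ (orbSum S lam) = orbSum R lam := by
  simp [orbSum]

theorem baseChange_kernel (t ε : S) (i : Fin n) (s : ℤˣ) :
    baseChange φ (kernel t ε i s) = kernel (φ t) (φ ε) i s := by
  simp only [kernel, map_mul, map_prod, kernelFactor, kernelPairFactor, apply_ite (baseChange φ),
    map_sub, map_add, baseChange_smul, baseChange_xvar, baseChange_zvar, map_pow, map_one,
    map_intCast]

theorem baseChange_shift (q : Sˣ) (i : Fin n) (s : ℤˣ) (f : Laurent S n) :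
    baseChange φ (shift q i s f) = shift (Units.map (φ : S →* R) q) i s (baseChange φ f) := by
  ext v
  rw [AddMonoidAlgebra.coeff_mapRingHom, coeff_shift, coeff_shift,
    AddMonoidAlgebra.coeff_mapRingHom, map_mul, ← map_zpow]
  rfl

theorem baseChange_diffOp (q : Sˣ) (t ε : S) (f : Laurent S n) :
    baseChange φ (diffOp q t ε f) =
      diffOp (Units.map (φ : S →* R) q) (φ t) (φ ε) (baseChange φ f) := by
  simp only [diffOp_apply, map_sum, map_mul, baseChange_kernel, baseChange_shift]

theorem map_eigenvalue (q : Sˣ) (t ε : S) (v : Weight n) :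
    φ (eigenvalue q t ε v) = eigenvalue (Units.map (φ : S →* R) q) (φ t) (φ ε) v := by
  simp only [eigenvalue, map_sum, map_mul, kernelTop, apply_ite φ, map_pow, ← map_zpow]
  rfl

end BaseChange

/-! ### Antisymmetry of the difference operator -/

section Weyl

variable {S : Type*} [CommRing S] {n : ℕ}

/-- The action of the Weyl group on Laurent polynomials. -/
abbrev weylAlg (σ : Equiv.Perm (Fin n)) (s : Fin n → ℤˣ) : Laurent S n ≃ₐ[S] Laurent S n :=
  AddMonoidAlgebra.domCongr S S (weylAct σ s)

/-- Invariance under the Weyl group. -/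
def IsInvariant (f : Laurent S n) : Prop := ∀ σ s, weylAlg σ s f = f

/-- The sign character of the Weyl group. -/
def weylSign (σ : Equiv.Perm (Fin n)) (s : Fin n → ℤˣ) : ℤˣ := Equiv.Perm.sign σ * ∏ i, s i

theorem coeff_weylAlg (σ : Equiv.Perm (Fin n)) (s : Fin n → ℤˣ) (f : Laurent S n) (v : Weight n) :
    (weylAlg σ s f).coeff (weylAct σ s v) = f.coeff v := by
  rw [AddMonoidAlgebra.coeff_domCongr, AddEquiv.symm_apply_apply]

theorem IsInvariant.coeff_weylAct {f : Laurent S n} (h : IsInvariant f) (σ : Equiv.Perm (Fin n))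
    (s : Fin n → ℤˣ) (v : Weight n) : f.coeff (weylAct σ s v) = f.coeff v := by
  conv_lhs => rw [← h σ s]
  exact coeff_weylAlg σ s f v

theorem isInvariant_iff {f : Laurent S n} :
    IsInvariant f ↔ ∀ σ s v, f.coeff (weylAct σ s v) = f.coeff v := by
  refine ⟨fun h => h.coeff_weylAct, fun h σ s => ?_⟩
  ext v
  obtain ⟨w, rfl⟩ := (weylAct σ s).surjective v
  rw [coeff_weylAlg, h]

theorem isInvariant_orbSum (lam : DominantWeight n) : IsInvariant (orbSum S lam) := by
  rw [isInvariant_iff]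
  intro σ s v
  simp only [coeff_orbSum, weylAct_mem_orbit_iff]

theorem IsInvariant.add {f g : Laurent S n} (hf : IsInvariant f) (hg : IsInvariant g) :
    IsInvariant (f + g) := fun σ s => by rw [map_add, hf, hg]

theorem IsInvariant.smul {f : Laurent S n} (hf : IsInvariant f) (c : S) :
    IsInvariant (c • f) := fun σ s => by rw [map_smul, hf]

theorem IsInvariant.sum {ι : Type*} {t : Finset ι} {f : ι → Laurent S n}
    (h : ∀ i ∈ t, IsInvariant (f i)) : IsInvariant (∑ i ∈ t, f i) := fun σ s => by
  rw [map_sum]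
  exact Finset.sum_congr rfl fun i hi => h i hi σ s

theorem weylAlg_xvar (σ : Equiv.Perm (Fin n)) (s : Fin n → ℤˣ) (i : Fin n) (a : ℤˣ) :
    weylAlg σ s (xvar S i a) = xvar S (σ i) (s (σ i) * a) := by
  rw [xvar, AddMonoidAlgebra.domCongr_single, weylAct_smul_eps, xvar]

theorem zvar_eq (i : Fin n) (a : ℤˣ) : zvar S i = xvar S i a + xvar S i (-a) := by
  rcases Int.units_eq_one_or a with rfl | rfl
  · rfl
  · rw [neg_neg, add_comm]; rfl

theorem xvar_sub_xvar (i : Fin n) (a : ℤˣ) :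
    xvar S i a - xvar S i (-a) = ((a : ℤ) : Laurent S n) * (xvar S i 1 - xvar S i (-1)) := by
  rcases Int.units_eq_one_or a with rfl | rfl <;> simp

theorem xvar_mul_xvar_neg (i : Fin n) (a : ℤˣ) : xvar S i a * xvar S i (-a) = 1 := by
  simp [xvar, AddMonoidAlgebra.single_mul_single, AddMonoidAlgebra.one_def]

theorem weylAlg_zvar (σ : Equiv.Perm (Fin n)) (s : Fin n → ℤˣ) (i : Fin n) :
    weylAlg σ s (zvar S i) = zvar S (σ i) := by
  rw [zvar, map_add, weylAlg_xvar, weylAlg_xvar, zvar_eq (σ i) (s (σ i)), mul_one, mul_neg_one]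

theorem weylAlg_weylDenom (σ : Equiv.Perm (Fin n)) (s : Fin n → ℤˣ) :
    weylAlg σ s (weylDenom S n) = ((weylSign σ s : ℤ) : Laurent S n) * weylDenom S n := by
  have h1 : weylAlg σ s (∏ j, (xvar S j 1 - xvar S j (-1))) =
      (((∏ j, s j : ℤˣ) : ℤ) : Laurent S n) * ∏ j, (xvar S j 1 - xvar S j (-1)) := by
    simp only [map_prod, map_sub, weylAlg_xvar, mul_one, mul_neg_one]
    rw [Equiv.prod_comp σ fun j => xvar S j (s j) - xvar S j (-s j)]
    simp only [xvar_sub_xvar _ (s _), Finset.prod_mul_distrib, Units.coe_prod, Int.cast_prod]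
  -- Mathlib's Vandermonde product has the differences in the order `v l - v j`, hence the nodes `-z
  -- j`.
  have h2 : ∀ z : Fin n → Laurent S n, (∏ j, ∏ l ∈ Finset.Ioi j, (z j - z l)) =
      (Matrix.vandermonde fun j => -z j).det := by
    intro z
    rw [Matrix.det_vandermonde]
    refine Finset.prod_congr rfl fun j _ => Finset.prod_congr rfl fun l _ => by ring
  have h3 : weylAlg σ s (∏ j, ∏ l ∈ Finset.Ioi j, (zvar S j - zvar S l)) =
      ((Equiv.Perm.sign σ : ℤ) : Laurent S n) * ∏ j, ∏ l ∈ Finset.Ioi j, (zvar S j - zvar S l) := by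
    simp only [map_prod, map_sub, weylAlg_zvar]
    rw [h2 fun j => zvar S (σ j), h2, ← Matrix.det_permute]
    rfl
  rw [weylDenom, map_mul, h1, h3, weylSign, Units.val_mul, Int.cast_mul]
  ring

/-! ### The Weyl group on the roots, and the coefficients of the operator as products over roots -/

theorem weylAct_mem_oddRoots (σ : Equiv.Perm (Fin n)) (s : Fin n → ℤˣ) {a : Weight n} :
    weylAct σ s a ∈ oddRoots n ↔ a ∈ oddRoots n := by
  have key : ∀ (σ : Equiv.Perm (Fin n)) (s : Fin n → ℤˣ) (a : Weight n), a ∈ oddRoots n →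
      weylAct σ s a ∈ oddRoots n := by
    intro σ s a ha
    simp only [oddRoots, Finset.mem_image, Finset.mem_univ, true_and] at ha ⊢
    obtain ⟨⟨i, u⟩, rfl⟩ := ha
    exact ⟨(σ i, s (σ i) * u), (weylAct_smul_eps σ s i u).symm⟩
  refine ⟨fun h => ?_, key σ s a⟩
  have h1 := key σ⁻¹ (fun i => s (σ i)) _ h
  rwa [← weylAct_symm_apply, AddEquiv.symm_apply_apply] at h1

theorem weylAct_mem_evenRoots (σ : Equiv.Perm (Fin n)) (s : Fin n → ℤˣ) {a : Weight n} :
    weylAct σ s a ∈ evenRoots n ↔ a ∈ evenRoots n := by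
  have key : ∀ (σ : Equiv.Perm (Fin n)) (s : Fin n → ℤˣ) (a : Weight n), a ∈ evenRoots n →
      weylAct σ s a ∈ evenRoots n := by
    intro σ s a ha
    simp only [evenRoots, Finset.mem_image, Finset.mem_filter, Finset.mem_univ, true_and] at ha ⊢
    obtain ⟨⟨⟨i, j⟩, u, w⟩, hij, rfl⟩ := ha
    refine ⟨((σ i, σ j), (s (σ i) * u, s (σ j) * w)), fun h => hij (σ.injective h), ?_⟩
    rw [map_add, weylAct_smul_eps, weylAct_smul_eps]
  refine ⟨fun h => ?_, key σ s a⟩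
  have h1 := key σ⁻¹ (fun i => s (σ i)) _ h
  rwa [← weylAct_symm_apply, AddEquiv.symm_apply_apply] at h1

theorem weylAct_mem_roots (σ : Equiv.Perm (Fin n)) (s : Fin n → ℤˣ) {a : Weight n} :
    weylAct σ s a ∈ roots n ↔ a ∈ roots n := by
  simp only [roots, Finset.mem_union, weylAct_mem_oddRoots, weylAct_mem_evenRoots]

theorem parity_weylAct (σ : Equiv.Perm (Fin n)) (s : Fin n → ℤˣ) (a : Weight n) :
    parity (weylAct σ s a) = parity a := by
  simp only [parity, weylAct_mem_oddRoots]

/-- The product of the `1 - ε^p(α) t e^α` over the roots `α` whose pairing with `s • ε_i` is `1`. -/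
def rootProd (t ε : S) (i : Fin n) (s : ℤˣ) : Laurent S n :=
  ∏ a ∈ roots n, if (s : ℤ) * a i = 1 then
    1 - (ε ^ parity a * t) • AddMonoidAlgebra.single a 1 else 1

theorem weylAlg_rootProd (t ε : S) (σ : Equiv.Perm (Fin n)) (s : Fin n → ℤˣ) (i : Fin n) (a : ℤˣ) :
    weylAlg σ s (rootProd t ε i a) = rootProd t ε (σ i) (s (σ i) * a) := by
  rw [rootProd, rootProd, map_prod]
  refine Finset.prod_equiv (weylAct σ s).toEquiv (fun b => (weylAct_mem_roots σ s).symm) ?_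
  intro b _
  have h : ((s (σ i) * a : ℤˣ) : ℤ) * (weylAct σ s b) (σ i) = a * b i := by
    rw [weylAct_apply, Equiv.symm_apply_apply]
    rcases Int.units_eq_one_or (s (σ i)) with h | h <;> simp [h]
  simp only [AddEquiv.toEquiv_eq_coe, AddEquiv.coe_toEquiv, h, parity_weylAct]
  split_ifs
  · rw [map_sub, map_one, map_smul, AddMonoidAlgebra.domCongr_single]
  · rw [map_one]

theorem mem_roots {a : Weight n} : a ∈ roots n ↔
    (∃ i j, i ≠ j ∧ ∃ u w : ℤˣ, a = (u : ℤ) • eps i + (w : ℤ) • eps j) ∨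
      ∃ i, ∃ u : ℤˣ, a = (u : ℤ) • eps i := by
  simp only [roots, evenRoots, oddRoots, Finset.mem_union, Finset.mem_image, Finset.mem_filter,
    Finset.mem_univ, true_and, Prod.exists]
  constructor
  · rintro (⟨i, j, u, w, hij, rfl⟩ | ⟨i, u, rfl⟩)
    · exact Or.inl ⟨i, j, hij, u, w, rfl⟩
    · exact Or.inr ⟨i, u, rfl⟩
  · rintro (⟨i, j, hij, u, w, rfl⟩ | ⟨i, u, rfl⟩)
    · exact Or.inl ⟨i, j, u, w, hij, rfl⟩
    · exact Or.inr ⟨i, u, rfl⟩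

theorem smul_eps_apply (u : ℤˣ) (i j : Fin n) :
    ((u : ℤ) • eps i : Weight n) j = if j = i then (u : ℤ) else 0 := by
  simp [eps, Pi.single_apply]

theorem ne_zero_of_mem_roots {a : Weight n} (h : a ∈ roots n) : a ≠ 0 := by
  rcases mem_roots.1 h with ⟨i, j, hij, u, w, rfl⟩ | ⟨i, u, rfl⟩
  · intro h0
    have := congrFun h0 i
    rw [Pi.add_apply, smul_eps_apply, smul_eps_apply, if_pos rfl, if_neg hij] at this
    simp at this
  · intro h0
    have := congrFun h0 i
    rw [smul_eps_apply, if_pos rfl] at this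
    simp at this

theorem parity_smul_eps (i : Fin n) (u : ℤˣ) : parity ((u : ℤ) • eps i) = 1 := by
  rw [parity, if_pos]
  simp only [oddRoots, Finset.mem_image, Finset.mem_univ, true_and]
  exact ⟨(i, u), rfl⟩

theorem parity_add {i j : Fin n} (hij : i ≠ j) (u w : ℤˣ) :
    parity ((u : ℤ) • eps i + (w : ℤ) • eps j) = 0 := by
  rw [parity, if_neg]
  simp only [oddRoots, Finset.mem_image, Finset.mem_univ, true_and, not_exists]
  rintro ⟨k, v⟩ h
  have hi := congrFun h i
  have hj := congrFun h j
  rw [Pi.add_apply, smul_eps_apply, smul_eps_apply, smul_eps_apply] at hi hj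
  rw [if_pos rfl, if_neg hij, add_zero] at hi
  rw [if_pos rfl, if_neg hij.symm, zero_add] at hj
  split_ifs at hi hj with h1 h2 h2
  · exact hij (h1.trans h2.symm)
  all_goals simp [eq_comm] at hi hj

theorem filter_roots (i : Fin n) (s : ℤˣ) :
    (roots n).filter (fun a => (s : ℤ) * a i = 1) =
      insert ((s : ℤ) • eps i) (((Finset.univ.erase i) ×ˢ (Finset.univ : Finset ℤˣ)).image
        fun p => (s : ℤ) • eps i + (p.2 : ℤ) • eps p.1) := by
  have hs : (s : ℤ) * s = 1 := by rw [← Units.val_mul, Int.units_mul_self, Units.val_one]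
  have hu : ∀ u : ℤˣ, (s : ℤ) * u = 1 → u = s := by
    intro u h
    rcases Int.units_eq_one_or s with rfl | rfl <;> rcases Int.units_eq_one_or u with rfl | rfl <;>
      simp at h ⊢
  ext a
  simp only [Finset.mem_filter, Finset.mem_insert, Finset.mem_image, Finset.mem_product,
    Finset.mem_erase, Finset.mem_univ, and_true, Prod.exists, mem_roots]
  constructor
  · rintro ⟨⟨j, l, hjl, u, w, rfl⟩ | ⟨j, u, rfl⟩, h⟩
    · right
      rw [Pi.add_apply, smul_eps_apply, smul_eps_apply] at h
      split_ifs at h with h1 h2 h2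
      · exact absurd (h1.symm.trans h2) hjl
      · subst h1
        rw [add_zero] at h
        exact ⟨l, w, Ne.symm h2, by rw [hu u h]⟩
      · subst h2
        rw [zero_add] at h
        exact ⟨j, u, Ne.symm h1, by rw [hu w h, add_comm]⟩
      · simp at h
    · left
      rw [smul_eps_apply] at h
      split_ifs at h with h1
      · subst h1; rw [hu u h]
      · simp at h
  · rintro (rfl | ⟨j, u, hj, rfl⟩)
    · exact ⟨Or.inr ⟨i, s, rfl⟩, by rw [smul_eps_apply, if_pos rfl, hs]⟩
    · refine ⟨Or.inl ⟨i, j, Ne.symm hj, s, u, rfl⟩, ?_⟩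
      rw [Pi.add_apply, smul_eps_apply, smul_eps_apply, if_pos rfl, if_neg (Ne.symm hj), add_zero,
        hs]

theorem rootProd_eq (t ε : S) (i : Fin n) (s : ℤˣ) :
    rootProd t ε i s = (1 - (ε * t) • xvar S i s) * ∏ l ∈ Finset.univ.erase i,
      (xvar S i s * (xvar S i (-s) - t • zvar S l + t ^ 2 • xvar S i s)) := by
  rw [rootProd, ← Finset.prod_filter, filter_roots, Finset.prod_insert, parity_smul_eps, pow_one,
    Finset.prod_image, Finset.prod_product]
  · congr 1
    refine Finset.prod_congr rfl fun l hl => ?_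
    have hil : i ≠ l := (Finset.ne_of_mem_erase hl).symm
    have h1 : ∀ u : ℤˣ, (AddMonoidAlgebra.single ((s : ℤ) • eps i + (u : ℤ) • eps l) 1 : Laurent S n)
        = xvar S i s * xvar S l u := fun u => by
      rw [xvar, xvar, AddMonoidAlgebra.single_mul_single, mul_one]
    simp only [parity_add hil, pow_zero, one_mul, h1]
    rw [UnitsInt.univ, Finset.prod_pair (by decide), zvar]
    have hX := xvar_mul_xvar_neg (S := S) i s
    have hY := xvar_mul_xvar_neg (S := S) l 1
    simp only [Algebra.smul_def, map_pow]
    linear_combination -hX + (algebraMap S (Laurent S n) t) ^ 2 * xvar S i s ^ 2 * hY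
  · rintro ⟨j, u⟩ hj ⟨l, w⟩ hl h
    simp only [Finset.coe_product, Set.mem_prod, Finset.mem_coe, Finset.mem_erase] at hj hl
    have h' := add_left_cancel h
    have h1 := congrFun h' j
    rw [smul_eps_apply, smul_eps_apply, if_pos rfl] at h1
    split_ifs at h1 with hjl
    · obtain rfl : j = l := hjl
      obtain rfl : u = w := Units.ext h1
      rfl
    · simp at h1
  · intro h
    obtain ⟨⟨j, u⟩, hj, h⟩ := Finset.mem_image.1 h
    have h1 : ((u : ℤ) • eps j : Weight n) = 0 := by simpa using h
    have h2 := congrFun h1 j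
    rw [smul_eps_apply, if_pos rfl] at h2
    simp at h2

theorem prod_kernelFactor_mul (t : S) {ε : S} (hε : ε ^ 2 = 1) (i : Fin n) (s : ℤˣ) :
    (∏ j, kernelFactor t ε i s j) * (1 - (ε * 1) • xvar S i s) =
      (∏ j, (xvar S j 1 - xvar S j (-1))) * (1 - (ε * t) • xvar S i s) := by
  rw [← Finset.mul_prod_erase _ _ (Finset.mem_univ i),
    ← Finset.mul_prod_erase _ _ (Finset.mem_univ i), Finset.prod_congr rfl fun j hj =>
      show kernelFactor t ε i s j = _ from if_neg (Finset.ne_of_mem_erase hj)]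
  have h1 : kernelFactor t ε i s i * (1 - (ε * 1) • xvar S i s) =
      (xvar S i 1 - xvar S i (-1)) * (1 - (ε * t) • xvar S i s) := by
    have h2 := xvar_sub_xvar (S := S) i s
    have hs' : xvar S i 1 - xvar S i (-1) =
        ((s : ℤ) : Laurent S n) * (xvar S i s - xvar S i (-s)) := by
      rw [h2, ← mul_assoc, ← Int.cast_mul, ← Units.val_mul, Int.units_mul_self]; simp
    have hX := xvar_mul_xvar_neg (S := S) i s
    have he : algebraMap S (Laurent S n) ε ^ 2 = 1 := by rw [← map_pow, hε, map_one]
    rw [hs', kernelFactor, if_pos rfl]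
    simp only [Algebra.smul_def, map_mul, map_pow, map_sub, map_one, map_intCast]
    set X := xvar S i s
    set X' := xvar S i (-s)
    set e := algebraMap S (Laurent S n) ε
    set T := algebraMap S (Laurent S n) t
    linear_combination (((s : ℤ) : Laurent S n)) * ((T * X - e * T * X ^ 2 + X * (1 - T)) * he +
      (e - e * T) * hX)
  linear_combination (∏ j ∈ Finset.univ.erase i, (xvar S j 1 - xvar S j (-1))) * h1

theorem prod_kernelPairFactor_mul (t : S) (i : Fin n) (s : ℤˣ) :
    (∏ j, ∏ l ∈ Finset.Ioi j, kernelPairFactor t i s j l) * (∏ l ∈ Finset.univ.erase i,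
      (xvar S i s * (xvar S i (-s) - (1 : S) • zvar S l + (1 : S) ^ 2 • xvar S i s))) =
    (∏ j, ∏ l ∈ Finset.Ioi j, (zvar S j - zvar S l)) * ∏ l ∈ Finset.univ.erase i,
      (xvar S i s * (xvar S i (-s) - t • zvar S l + t ^ 2 • xvar S i s)) := by
  have h : ∀ f : Fin n → Laurent S n, ∏ l ∈ Finset.univ.erase i, f l =
      ∏ j, ∏ l ∈ Finset.Ioi j, (if j = i then f l else if l = i then f j else 1) := by
    intro f
    rw [prod_pairs_eq, ← Finset.prod_union]
    · refine Finset.prod_congr ?_ fun _ _ => rfl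
      ext j
      simp only [Finset.mem_erase, Finset.mem_univ, and_true, Finset.mem_union, Finset.mem_Ioi,
        Finset.mem_Iio]
      exact ⟨fun h => (lt_or_gt_of_ne h).symm, fun h => h.elim (fun h => h.ne') fun h => h.ne⟩
    · rw [Finset.disjoint_left]
      intro j h1 h2
      exact absurd (Finset.mem_Ioi.1 h1) (lt_asymm (Finset.mem_Iio.1 h2))
  rw [h, h]
  simp only [← Finset.prod_mul_distrib]
  refine Finset.prod_congr rfl fun j _ => Finset.prod_congr rfl fun l _ => ?_
  have hz := zvar_eq (S := S) i s
  unfold kernelPairFactor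
  split_ifs with h1 h2
  · subst h1
    rw [hz, one_smul, one_pow, one_smul]
    ring
  · subst h2
    rw [hz, one_smul, one_pow, one_smul]
    ring
  · rfl

/-- The fraction-free form of `kernel = weylDenom * A_{i,s}`. The Weyl group visibly permutes the
products `rootProd`, so the behaviour of `kernel` under it follows by cancelling `rootProd 1`. -/
theorem kernel_mul_rootProd (t : S) {ε : S} (hε : ε ^ 2 = 1) (i : Fin n) (s : ℤˣ) :
    kernel t ε i s * rootProd 1 ε i s = weylDenom S n * rootProd t ε i s := by
  have h1 := prod_kernelFactor_mul t hε i s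
  have h2 := prod_kernelPairFactor_mul t i s
  rw [rootProd_eq, rootProd_eq, kernel, weylDenom, mul_mul_mul_comm, h1, h2, mul_mul_mul_comm]

theorem one_sub_smul_single_ne_zero [Nontrivial S] {a : Weight n} (ha : a ≠ 0) (c : S) :
    (1 - c • AddMonoidAlgebra.single a 1 : Laurent S n) ≠ 0 := by
  intro h
  have h1 : (1 - c • AddMonoidAlgebra.single a 1 : Laurent S n).coeff 0 = 1 := by
    simp [AddMonoidAlgebra.one_def, ha]
  rw [h] at h1
  simp at h1

theorem rootProd_ne_zero [IsDomain S] (t ε : S) (i : Fin n) (s : ℤˣ) :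
    rootProd t ε i s ≠ 0 := by
  refine Finset.prod_ne_zero_iff.2 fun a ha => ?_
  split_ifs
  · exact one_sub_smul_single_ne_zero (ne_zero_of_mem_roots ha) _
  · exact one_ne_zero

theorem weylDenom_ne_zero [Nontrivial S] : weylDenom S n ≠ 0 := by
  intro h
  have := (hasTop_weylDenom (S := S) (n := n)).coeff_top
  rw [h] at this
  simp at this

theorem weylAlg_kernel [IsDomain S] (t : S) {ε : S} (hε : ε ^ 2 = 1) (σ : Equiv.Perm (Fin n))
    (s : Fin n → ℤˣ) (i : Fin n) (a : ℤˣ) :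
    weylAlg σ s (kernel t ε i a) =
      ((weylSign σ s : ℤ) : Laurent S n) * kernel t ε (σ i) (s (σ i) * a) := by
  refine mul_right_cancel₀ (rootProd_ne_zero 1 ε (σ i) (s (σ i) * a)) ?_
  rw [← weylAlg_rootProd, ← map_mul, kernel_mul_rootProd t hε, map_mul, weylAlg_weylDenom,
    weylAlg_rootProd, weylAlg_rootProd, mul_assoc, mul_assoc, kernel_mul_rootProd t hε]

theorem weylAlg_shift (q : Sˣ) (σ : Equiv.Perm (Fin n)) (s : Fin n → ℤˣ) (i : Fin n) (a : ℤˣ)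
    (f : Laurent S n) :
    weylAlg σ s (shift q i a f) = shift q (σ i) (s (σ i) * a) (weylAlg σ s f) := by
  ext v
  obtain ⟨w, rfl⟩ := (weylAct σ s).surjective v
  have h : ((s (σ i) * a : ℤˣ) : ℤ) * (weylAct σ s w) (σ i) = a * w i := by
    rw [weylAct_apply, Equiv.symm_apply_apply]
    rcases Int.units_eq_one_or (s (σ i)) with h | h <;> simp [h]
  rw [coeff_weylAlg, coeff_shift, coeff_shift, coeff_weylAlg, h]

theorem weylAlg_diffOp [IsDomain S] (q : Sˣ) (t : S) {ε : S} (hε : ε ^ 2 = 1)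
    (σ : Equiv.Perm (Fin n)) (s : Fin n → ℤˣ) {f : Laurent S n} (hf : IsInvariant f) :
    weylAlg σ s (diffOp q t ε f) = ((weylSign σ s : ℤ) : Laurent S n) * diffOp q t ε f := by
  rw [diffOp_apply, map_sum, Finset.mul_sum]
  have hinj : Function.Injective fun p : Fin n × ℤˣ => (σ p.1, s (σ p.1) * p.2) := by
    rintro ⟨i, a⟩ ⟨j, b⟩ h
    simp only [Prod.mk.injEq] at h
    obtain rfl := σ.injective h.1
    obtain rfl := mul_left_cancel h.2
    rfl
  refine Function.Bijective.sum_comp (Finite.injective_iff_bijective.1 hinj) (fun p =>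
    ((weylSign σ s : ℤ) : Laurent S n) * (kernel t ε p.1 p.2 * shift q p.1 p.2 f)) |>.symm.trans ?_
    |>.symm
  refine Finset.sum_congr rfl fun p _ => ?_
  rw [map_mul, weylAlg_kernel t hε, weylAlg_shift, hf, mul_assoc]

/-- A nonzero coefficient can be moved by `W` to a dominant weight `u`. Antisymmetry excludes
weights fixed by an element of sign `-1`, so `u` has strictly decreasing positive coordinates, which
means that `u - ρ` is dominant. -/
theorem eq_zero_of_antisymmetric [IsDomain S] [CharZero S] {h : Laurent S n}
    (hanti : ∀ σ s, weylAlg σ s h = ((weylSign σ s : ℤ) : Laurent S n) * h)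
    (lam : DominantWeight n) (htop : ∀ v, ¬ DomLE v (lam.1 + rho n) → h.coeff v = 0)
    (hcoeff : ∀ mu : DominantWeight n, DomLE mu.1 lam.1 → h.coeff (mu.1 + rho n) = 0) : h = 0 := by
  have key : ∀ σ s v, h.coeff (weylAct σ s v) = ((weylSign σ s : ℤ) : S) * h.coeff v := by
    intro σ s v
    have h1 := coeff_weylAlg σ s h v
    rw [hanti, ← zsmul_eq_mul, AddMonoidAlgebra.coeff_smul, Finsupp.smul_apply,
      zsmul_eq_mul] at h1
    rw [← h1, ← mul_assoc, ← Int.cast_mul, ← Units.val_mul, Int.units_mul_self]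
    simp
  have hzero : ∀ σ s v, weylAct σ s v = v → weylSign σ s = -1 → h.coeff v = 0 := by
    intro σ s v hv hs
    have h1 := key σ s v
    rw [hv, hs] at h1
    simp only [Units.val_neg, Units.val_one, Int.cast_neg, Int.cast_one, neg_mul, one_mul] at h1
    exact self_eq_neg.1 h1
  ext v
  rw [AddMonoidAlgebra.coeff_zero, Finsupp.zero_apply]
  by_contra hv
  obtain ⟨σ, s, hanti', hpos⟩ := exists_weylAct_dominant v
  set u := weylAct σ s v with hu
  have hu0 : h.coeff u ≠ 0 := by
    rw [hu, key]
    refine mul_ne_zero ?_ hv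
    exact_mod_cast (weylSign σ s).ne_zero
  have hpos' : ∀ i, 1 ≤ u i := by
    intro i
    by_contra hi
    have hi0 : u i = 0 := le_antisymm (by omega) (hpos i)
    -- The sign change of a zero coordinate fixes `u` and has sign `-1`; below, the transposition of
    -- two equal coordinates does the same.
    refine hu0 (hzero 1 (Function.update 1 i (-1)) u ?_ ?_)
    · funext j
      rw [weylAct_apply]
      change _ * u j = _
      by_cases hj : j = i
      · subst hj; simp [hi0]
      · simp [hj]
    · simp [weylSign, Finset.prod_update_of_mem]
  have hstrict : ∀ i j, i < j → u j + 1 ≤ u i := by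
    intro i j hij
    by_contra hlt
    have hle : u j ≤ u i := hanti' hij.le
    have heq : u i = u j := by omega
    refine hu0 (hzero (Equiv.swap i j) 1 u ?_ ?_)
    · funext l
      rw [weylAct_apply, Equiv.symm_swap]
      simp only [Pi.one_apply, Units.val_one, one_mul]
      by_cases hl : l = i
      · subst hl; rw [Equiv.swap_apply_left, heq]
      · by_cases hl' : l = j
        · subst hl'; rw [Equiv.swap_apply_right, heq]
        · rw [Equiv.swap_apply_of_ne_of_ne hl hl']
    · simp [weylSign, Equiv.Perm.sign_swap hij.ne]
  -- Strict decrease of integers gives a drop of at least `d` over `d` places. Measured from the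
  -- last coordinate, which is at least `1`, it gives `u i ≥ n - i = ρ i`.
  have hgap : ∀ d : ℕ, ∀ i j : Fin n, (j : ℕ) = i + d → u j + d ≤ u i := by
    intro d
    induction d with
    | zero =>
      intro i j hij
      obtain rfl : i = j := Fin.ext (by omega)
      simp
    | succ d ih =>
      intro i j hij
      have hd : (i : ℕ) + d < n := by have := j.2; omega
      have h1 := ih i ⟨i + d, hd⟩ rfl
      have h2 := hstrict ⟨i + d, hd⟩ j (by rw [Fin.lt_def]; simp only; omega)
      push_cast
      linarith
  let mu : DominantWeight n := ⟨u - rho n, by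
    constructor
    · intro i j hij
      have hij' : (i : ℕ) ≤ j := hij
      have := hgap ((j : ℕ) - i) i j (by omega)
      simp only [Pi.sub_apply, rho]
      omega
    · intro i
      have hi := i.2
      have hn : n - 1 < n := by omega
      have h1 := hgap (n - 1 - i) i ⟨n - 1, hn⟩ (by simp only; omega)
      have h2 := hpos' ⟨n - 1, hn⟩
      simp only [Pi.sub_apply, rho]
      omega⟩
  have hmu : u = mu.1 + rho n := by simp [mu]
  rw [hmu] at hu0
  refine hu0 (hcoeff mu ?_)
  by_contra hle
  exact hu0 (htop _ fun h' => hle (domLE_add_right_iff.1 h'))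

end Weyl

/-! ### The pairing and the adjointness of the difference operator -/

section Pairing

variable {S : Type*} [CommRing S] {n : ℕ}

variable (n) in
/-- The weight function `Δ` over a commutative ring. -/
def weightProd (q ε : S) (k : ℕ) : Laurent S n :=
  ∏ a ∈ roots n, ∏ r ∈ Finset.range k, (1 - (ε ^ parity a * q ^ r) • AddMonoidAlgebra.single a 1)

/-- The involution `e^v ↦ e^(-v)` over a commutative ring. -/
abbrev conjAlg : Laurent S n ≃ₐ[S] Laurent S n :=
  AddMonoidAlgebra.domCongr S S (AddEquiv.neg (Weight n))

/-- The pairing over a commutative ring. -/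
def pair (q ε : S) (k : ℕ) (f g : Laurent S n) : S :=
  (f * conjAlg g * weightProd n q ε k).coeff 0

theorem pair_add_left (q ε : S) (k : ℕ) (f f' g : Laurent S n) :
    pair q ε k (f + f') g = pair q ε k f g + pair q ε k f' g := by
  simp [pair, add_mul]

theorem pair_smul_left (q ε : S) (k : ℕ) (c : S) (f g : Laurent S n) :
    pair q ε k (c • f) g = c * pair q ε k f g := by
  simp [pair]

/-- The pairing as a bilinear form. -/
def pairForm (q ε : S) (k : ℕ) : LinearMap.BilinForm S (Laurent S n) :=
  LinearMap.mk₂ S (pair q ε k) (pair_add_left q ε k) (pair_smul_left q ε k)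
    (fun f g g' => by simp [pair, add_mul, mul_add]) (fun c f g => by simp [pair])

theorem pairForm_apply (q ε : S) (k : ℕ) (f g : Laurent S n) :
    pairForm q ε k f g = pair q ε k f g := rfl

/-- The map `-1` belongs to the Weyl group. -/
theorem IsInvariant.conjAlg_eq {f : Laurent S n} (hf : IsInvariant f) : conjAlg f = f := by
  ext v
  obtain ⟨w, rfl⟩ := (AddEquiv.neg (Weight n)).surjective v
  rw [AddMonoidAlgebra.coeff_domCongr, AddEquiv.symm_apply_apply, ← hf.coeff_weylAct 1 (-1) w]
  congr 1
  funext i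
  rw [weylAct_apply]
  change _ * w i = - w i
  simp

/-- The product of `Δ` with the coefficient of the `q`-shift in the direction `s • ε_i` in the
difference operator. -/
def shiftedWeight (q ε : S) (k : ℕ) (i : Fin n) (s : ℤˣ) : Laurent S n :=
  ∏ a ∈ roots n, if (s : ℤ) * a i = 1
    then ∏ r ∈ Finset.range k, (1 - (ε ^ parity a * q ^ (r + 1)) • AddMonoidAlgebra.single a 1)
    else ∏ r ∈ Finset.range k, (1 - (ε ^ parity a * q ^ r) • AddMonoidAlgebra.single a 1)

/-- For a root of pairing `1`, both sides run over the exponents `0, ..., k`: one splits off the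
first, the other the last. -/
theorem shiftedWeight_mul_rootProd (q ε : S) (k : ℕ) (i : Fin n) (s : ℤˣ) :
    shiftedWeight q ε k i s * rootProd 1 ε i s = weightProd n q ε k * rootProd (q ^ k) ε i s := by
  rw [shiftedWeight, rootProd, weightProd, rootProd, ← Finset.prod_mul_distrib,
    ← Finset.prod_mul_distrib]
  refine Finset.prod_congr rfl fun a _ => ?_
  split_ifs
  · rw [← Finset.prod_range_succ (fun r =>
      (1 - (ε ^ parity a * q ^ r) • AddMonoidAlgebra.single a 1 : Laurent S n)),
      Finset.prod_range_succ', pow_zero]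
  · rfl

theorem pairing_roots {a : Weight n} (ha : a ∈ roots n) (i : Fin n) (s : ℤˣ) :
    (s : ℤ) * a i = 1 ∨ (s : ℤ) * a i = 0 ∨ (s : ℤ) * a i = -1 := by
  have h1 : ∀ u : ℤˣ, (s : ℤ) * u = 1 ∨ (s : ℤ) * u = 0 ∨ (s : ℤ) * u = -1 := fun u => by
    rcases Int.units_eq_one_or s with rfl | rfl <;>
      rcases Int.units_eq_one_or u with rfl | rfl <;> simp
  rcases mem_roots.1 ha with ⟨j, l, hjl, u, w, rfl⟩ | ⟨j, u, rfl⟩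
  · rw [Pi.add_apply, smul_eps_apply, smul_eps_apply]
    split_ifs with hj hl hl
    · exact absurd (hj.symm.trans hl) hjl
    · rw [add_zero]; exact h1 u
    · rw [zero_add]; exact h1 w
    · simp
  · rw [smul_eps_apply]
    split_ifs
    · exact h1 u
    · simp

theorem shift_one_sub (q : Sˣ) (i : Fin n) (s : ℤˣ) (c : S) (a : Weight n) :
    shift q i s (1 - c • AddMonoidAlgebra.single a 1) =
      1 - (c * ((q ^ ((s : ℤ) * a i) : Sˣ) : S)) • AddMonoidAlgebra.single a 1 := by
  rw [map_sub, map_one, map_smul, shift_single, mul_one, AddMonoidAlgebra.smul_single,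
    AddMonoidAlgebra.smul_single, smul_eq_mul, smul_eq_mul, mul_one]

/-- Minuscule pairings matter here: the shift moves the exponents `1, ..., k` to `0, ..., k - 1` on
roots of pairing `1`, does the reverse on pairing `-1`, and leaves pairing `0` alone. -/
theorem shift_shiftedWeight (q : Sˣ) (ε : S) (k : ℕ) (i : Fin n) (s : ℤˣ) :
    shift q i (-s) (shiftedWeight (q : S) ε k i s) = shiftedWeight (q : S) ε k i (-s) := by
  rw [shiftedWeight, shiftedWeight, map_prod]
  refine Finset.prod_congr rfl fun a ha => ?_
  rw [apply_ite (shift q i (-s)), map_prod, map_prod]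
  simp only [shift_one_sub, Units.val_neg, neg_mul]
  rcases pairing_roots ha i s with h | h | h
  · rw [if_pos h, if_neg (by omega), h]
    refine Finset.prod_congr rfl fun r _ => ?_
    simp [pow_succ, mul_assoc]
  · rw [if_neg (by omega), if_neg (by omega), h]
    simp
  · rw [if_neg (by omega), if_pos (by omega), h]
    refine Finset.prod_congr rfl fun r _ => ?_
    simp [pow_succ, mul_assoc]

theorem shift_neg_shift (q : Sˣ) (i : Fin n) (s : ℤˣ) (f : Laurent S n) :
    shift q i (-s) (shift q i s f) = f := by
  ext v
  rw [coeff_shift, coeff_shift, ← mul_assoc, ← Units.val_mul, ← zpow_add]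
  simp

theorem coeff_zero_shift (q : Sˣ) (i : Fin n) (s : ℤˣ) (f : Laurent S n) :
    (shift q i s f).coeff 0 = f.coeff 0 := by
  rw [coeff_shift]; simp

/-- Trades the multiplier `weylDenom` for `Δ`, the form in which self-adjointness is visible; both
equations are multiples of the same eigenvector equation. -/
theorem sum_shiftedWeight_mul_shift [IsDomain S] (q : Sˣ) {ε : S} (hε : ε ^ 2 = 1) (k : ℕ)
    {f : Laurent S n} {E : S} (hf : diffOp q ((q : S) ^ k) ε f = E • (weylDenom S n * f)) :
    ∑ p : Fin n × ℤˣ, shiftedWeight (q : S) ε k p.1 p.2 * shift q p.1 p.2 f =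
      E • (f * weightProd n (q : S) ε k) := by
  have h : ∀ p : Fin n × ℤˣ, weylDenom S n * shiftedWeight (q : S) ε k p.1 p.2 =
      weightProd n (q : S) ε k * kernel ((q : S) ^ k) ε p.1 p.2 := by
    intro p
    refine mul_right_cancel₀ (rootProd_ne_zero 1 ε p.1 p.2) ?_
    rw [mul_assoc, shiftedWeight_mul_rootProd, mul_assoc, kernel_mul_rootProd _ hε]
    ring
  refine mul_left_cancel₀ (weylDenom_ne_zero (S := S) (n := n)) ?_
  rw [Finset.mul_sum]
  simp only [← mul_assoc, h]
  simp only [mul_assoc]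
  rw [← Finset.mul_sum, ← diffOp_apply, hf]
  simp only [Algebra.smul_def]
  ring

/-- Applying the shift by `(i, -s)` to the summand of `(i, s)` keeps its constant term, takes the
shift off `f` and puts the opposite one on `g`. -/
theorem coeff_zero_sum_comm (q : Sˣ) (ε : S) (k : ℕ) (f g : Laurent S n) :
    ((∑ p : Fin n × ℤˣ, shiftedWeight (q : S) ε k p.1 p.2 * shift q p.1 p.2 f) * g).coeff 0 =
      ((∑ p : Fin n × ℤˣ, shiftedWeight (q : S) ε k p.1 p.2 * shift q p.1 p.2 g) * f).coeff 0 := by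
  rw [Finset.sum_mul, Finset.sum_mul, AddMonoidAlgebra.coeff_sum, AddMonoidAlgebra.coeff_sum,
    Finsupp.finsetSum_apply, Finsupp.finsetSum_apply]
  refine Fintype.sum_equiv ((Equiv.refl (Fin n)).prodCongr (Equiv.neg ℤˣ)) _ _ fun p => ?_
  rw [← coeff_zero_shift q p.1 (-p.2), map_mul, map_mul, shift_shiftedWeight, shift_neg_shift]
  simp only [Equiv.prodCongr_apply, Prod.map_fst, Equiv.refl_apply, Prod.map_snd, Equiv.neg_apply]
  congr 2
  ring

theorem pair_eq_zero_of_eigenvalue_ne [IsDomain S] (q : Sˣ) {ε : S} (hε : ε ^ 2 = 1) (k : ℕ)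
    {f g : Laurent S n} (hgi : IsInvariant g) {E E' : S}
    (hf : diffOp q ((q : S) ^ k) ε f = E • (weylDenom S n * f))
    (hg : diffOp q ((q : S) ^ k) ε g = E' • (weylDenom S n * g)) (hE : E ≠ E') :
    pair (q : S) ε k f g = 0 := by
  have h := coeff_zero_sum_comm q ε k f g
  rw [sum_shiftedWeight_mul_shift q hε k hf, sum_shiftedWeight_mul_shift q hε k hg] at h
  have h1 : f * weightProd n (q : S) ε k * g = f * g * weightProd n (q : S) ε k := by ring
  have h2 : g * weightProd n (q : S) ε k * f = f * g * weightProd n (q : S) ε k := by ring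
  rw [smul_mul_assoc, smul_mul_assoc, h1, h2, AddMonoidAlgebra.coeff_smul,
    AddMonoidAlgebra.coeff_smul, Finsupp.smul_apply, Finsupp.smul_apply, smul_eq_mul,
    smul_eq_mul] at h
  rw [pair, hgi.conjAlg_eq]
  by_contra h0
  exact hE (mul_right_cancel₀ h0 h)

theorem map_pair {R : Type*} [CommRing R] (φ : S →+* R) (q ε : S) (k : ℕ) (f g : Laurent S n) :
    φ (pair q ε k f g) = pair (φ q) (φ ε) k (baseChange φ f) (baseChange φ g) := by
  have h1 : baseChange φ (weightProd n q ε k) = weightProd n (φ q) (φ ε) k := by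
    simp only [weightProd, map_prod, map_sub, map_one, baseChange_smul, map_mul, map_pow,
      AddMonoidAlgebra.mapRingHom_single]
  have h2 : baseChange φ (conjAlg g) = conjAlg (baseChange φ g) := by
    ext v
    simp only [AddMonoidAlgebra.coeff_mapRingHom, AddMonoidAlgebra.coeff_domCongr]
  rw [pair, pair, ← h1, ← h2, ← map_mul, ← map_mul, AddMonoidAlgebra.coeff_mapRingHom]

/-! ### Positivity -/

theorem coeff_zero_mul_conjAlg (f g : Laurent S n) :
    (f * conjAlg g).coeff 0 = f.coeff.sum fun v c => c * g.coeff v := by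
  induction f using AddMonoidAlgebra.induction_linear with
  | zero => simp
  | add f f' hf hf' =>
    rw [add_mul, AddMonoidAlgebra.coeff_add, Finsupp.add_apply, hf, hf',
      AddMonoidAlgebra.coeff_add, Finsupp.sum_add_index'] <;> simp [add_mul]
  | single v r =>
    have h := AddMonoidAlgebra.coeff_single_mul_apply (conjAlg g) r v 0
    rw [h, AddMonoidAlgebra.coeff_domCongr, AddMonoidAlgebra.coeff_single,
      Finsupp.sum_single_index (by simp)]
    simp

theorem neg_mem_roots {a : Weight n} : -a ∈ roots n ↔ a ∈ roots n := by
  have key : weylAct 1 (-1) a = -a := by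
    funext i
    rw [weylAct_apply]
    change _ * a i = - a i
    simp
  rw [← key, weylAct_mem_roots]

theorem parity_neg (a : Weight n) : parity (-a) = parity a := by
  have key : weylAct 1 (-1) a = -a := by
    funext i
    rw [weylAct_apply]
    change _ * a i = - a i
    simp
  rw [← key, parity_weylAct]

theorem height_ne_zero_of_mem_roots {a : Weight n} (ha : a ∈ roots n) : height a ≠ 0 := by
  rcases mem_roots.1 ha with ⟨i, j, hij, u, w, rfl⟩ | ⟨i, u, rfl⟩
  · have hi := i.2
    have hj := j.2
    have : (i : ℕ) ≠ j := fun h => hij (Fin.ext h)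
    rw [map_add, map_zsmul, map_zsmul, height_eps, height_eps]
    rcases Int.units_eq_one_or u with rfl | rfl <;>
      rcases Int.units_eq_one_or w with rfl | rfl <;> simp <;> omega
  · have hi := i.2
    rw [map_zsmul, height_eps]
    rcases Int.units_eq_one_or u with rfl | rfl <;> simp <;> omega

/-- The roots split by the sign of `height`, which is nonzero on them, and conjugation exchanges the
two halves. -/
theorem weightProd_eq_mul_conjAlg (q ε : S) (k : ℕ) :
    ∃ ψ : Laurent S n, weightProd n q ε k = ψ * conjAlg ψ ∧ ([IsDomain S] → ψ ≠ 0) := by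
  refine ⟨∏ a ∈ (roots n).filter fun a => 0 < height a, ∏ r ∈ Finset.range k,
    (1 - (ε ^ parity a * q ^ r) • AddMonoidAlgebra.single a 1), ?_, ?_⟩
  · rw [weightProd, ← Finset.prod_filter_mul_prod_filter_not (roots n) fun a => 0 < height a,
      map_prod]
    congr 1
    refine (Finset.prod_equiv (Equiv.neg (Weight n)) (fun a => ?_) fun a _ => ?_).symm
    · simp only [Finset.mem_filter, Equiv.neg_apply, neg_mem_roots, map_neg]
      refine and_congr_right fun ha => ?_
      have := height_ne_zero_of_mem_roots ha
      omega
    · rw [map_prod]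
      refine Finset.prod_congr rfl fun r _ => ?_
      rw [map_sub, map_one, map_smul, AddMonoidAlgebra.domCongr_single]
      simp only [Equiv.neg_apply, parity_neg, AddEquiv.neg_apply]
  · intro _
    refine Finset.prod_ne_zero_iff.2 fun a ha => Finset.prod_ne_zero_iff.2 fun r _ => ?_
    exact one_sub_smul_single_ne_zero (ne_zero_of_mem_roots (Finset.mem_filter.1 ha).1) _

/-- With `Δ = ψ ψ̄`, the norm is the sum of the squared coefficients of `f ψ`. -/
theorem pair_self_pos (q ε : ℝ) (k : ℕ) {f : Laurent ℝ n} (hf : f ≠ 0) : 0 < pair q ε k f f := by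
  obtain ⟨ψ, hψ, hψ0⟩ := weightProd_eq_mul_conjAlg (n := n) q ε k
  have h : pair q ε k f f = ((f * ψ) * conjAlg (f * ψ)).coeff 0 := by
    rw [pair, hψ, map_mul]
    congr 2
    ring
  rw [h, coeff_zero_mul_conjAlg]
  have h0 : (f * ψ).coeff ≠ 0 := fun h => mul_ne_zero hf hψ0 (AddMonoidAlgebra.coeff_eq_zero.1 h)
  refine Finset.sum_pos (fun v hv => ?_) (Finsupp.support_nonempty_iff.2 h0)
  exact mul_self_pos.2 (Finsupp.mem_support_iff.1 hv)

/-! ### Eigenvectors -/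

/-- Indices are added so that the new one, `a`, has minimal `h`. Its unknown then occurs in none of
the equations already solved, and the equation at `a` determines it. -/
theorem exists_triangular_solution {ι : Type*} [DecidableEq ι] (h : ι → ℤ) (M : ι → ι → S)
    (b : ι → S) (s : Finset ι) (hM : ∀ i j, i ≠ j → h i ≤ h j → M i j = 0)
    (hd : ∀ i ∈ s, IsUnit (M i i)) : ∃ u : ι → S, ∀ j ∈ s, ∑ i ∈ s, u i * M i j = b j := by
  induction s using Finset.induction_on_min_value h with
  | empty => exact ⟨0, by simp⟩
  | insert a s ha hmin ih =>
    obtain ⟨u, hu⟩ := ih fun i hi => hd i (Finset.mem_insert_of_mem hi)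
    obtain ⟨c, hc⟩ := hd a (Finset.mem_insert_self a s)
    refine ⟨Function.update u a ((b a - ∑ i ∈ s, u i * M i a) * (c⁻¹ : Sˣ)), fun j hj => ?_⟩
    have h1 (x : S) : ∑ i ∈ s, Function.update u a x i * M i j = ∑ i ∈ s, u i * M i j :=
      Finset.sum_congr rfl fun i hi => by
        rw [Function.update_of_ne (ne_of_mem_of_not_mem hi ha)]
    rw [Finset.sum_insert ha, Function.update_self, h1]
    rcases Finset.mem_insert.1 hj with rfl | hj
    · rw [← hc, mul_assoc, Units.inv_mul]; ring
    · rw [hM a j (ne_of_mem_of_not_mem hj ha).symm (hmin j hj), mul_zero, zero_add, hu j hj]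

/-- The triangular combination of orbit sums with the coefficients `u`. -/
def triSum (u : DominantWeight n → DominantWeight n → S) (lam : DominantWeight n) : Laurent S n :=
  orbSum S lam + ∑ mu ∈ below lam, u lam mu • orbSum S mu

/-- Only the coefficients at `mu + ρ` are imposed, so `ε^2 = 1` is not needed and `ε` may be an
indeterminate. That these conditions suffice is seen only after specialization, in `diffOp_triSum`.
-/
theorem exists_coeff_eq_zero (q : Sˣ) (t ε : S)
    (hE : ∀ lam : DominantWeight n, ∀ mu ∈ below lam,
      IsUnit (eigenvalue q t ε mu.1 - eigenvalue q t ε lam.1)) :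
    ∃ u : DominantWeight n → DominantWeight n → S, ∀ lam, ∀ mu ∈ below lam,
      (diffOp q t ε (triSum u lam) -
        eigenvalue q t ε lam.1 • (weylDenom S n * triSum u lam)).coeff (mu.1 + rho n) = 0 := by
  classical
  have key : ∀ lam : DominantWeight n, ∃ u : DominantWeight n → S, ∀ mu ∈ below lam,
      (diffOp q t ε (orbSum S lam + ∑ nu ∈ below lam, u nu • orbSum S nu) -
        eigenvalue q t ε lam.1 • (weylDenom S n *
          (orbSum S lam + ∑ nu ∈ below lam, u nu • orbSum S nu))).coeff (mu.1 + rho n) = 0 := by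
    intro lam
    let A : Laurent S n →ₗ[S] Laurent S n :=
      diffOp q t ε - eigenvalue q t ε lam.1 • LinearMap.mulLeft S (weylDenom S n)
    have hA : ∀ nu : DominantWeight n, HasTop (A (orbSum S nu)) (nu.1 + rho n)
        (eigenvalue q t ε nu.1 - eigenvalue q t ε lam.1) := by
      intro nu
      have h1 := (hasTop_orbSum (S := S) nu).diffOp q t ε
      have h2 := ((hasTop_weylDenom (S := S) (n := n)).mul (hasTop_orbSum nu)).smul
        (eigenvalue q t ε lam.1)
      rw [mul_one, mul_one, add_comm (rho n)] at h2
      exact h1.sub h2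
    obtain ⟨u, hu⟩ := exists_triangular_solution (fun nu : DominantWeight n => height nu.1)
      (fun nu mu => (A (orbSum S nu)).coeff (mu.1 + rho n))
      (fun mu => -(A (orbSum S lam)).coeff (mu.1 + rho n)) (below lam)
      (fun nu mu hne hle => (hA nu).coeff_eq_zero fun hdom => by
        have := (domLE_add_right_iff.1 hdom).height_lt fun h' => hne (Subtype.ext h'.symm)
        exact absurd hle (not_le.2 this))
      (fun nu hnu => by rw [(hA nu).coeff_top]; exact hE lam nu hnu)
    refine ⟨u, fun mu hmu => ?_⟩
    have h1 : diffOp q t ε (orbSum S lam + ∑ nu ∈ below lam, u nu • orbSum S nu) -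
        eigenvalue q t ε lam.1 • (weylDenom S n *
          (orbSum S lam + ∑ nu ∈ below lam, u nu • orbSum S nu)) =
        A (orbSum S lam) + ∑ nu ∈ below lam, u nu • A (orbSum S nu) := by
      have h2 := map_add A (orbSum S lam) (∑ nu ∈ below lam, u nu • orbSum S nu)
      rw [map_sum] at h2
      simp only [map_smul] at h2
      exact h2
    rw [h1, AddMonoidAlgebra.coeff_add, Finsupp.add_apply, AddMonoidAlgebra.coeff_sum,
      Finsupp.finsetSum_apply]
    have h2 := hu mu hmu
    simp only [AddMonoidAlgebra.coeff_smul, Finsupp.smul_apply, smul_eq_mul]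
    rw [h2, add_neg_cancel]
  choose u hu using key
  exact ⟨u, hu⟩

theorem isInvariant_triSum (u : DominantWeight n → DominantWeight n → S) (lam : DominantWeight n) :
    IsInvariant (triSum u lam) :=
  (isInvariant_orbSum lam).add (IsInvariant.sum fun mu _ => (isInvariant_orbSum mu).smul _)

theorem hasTop_triSum (u : DominantWeight n → DominantWeight n → S) (lam : DominantWeight n) :
    HasTop (triSum u lam) lam.1 1 := by
  have h : HasTop (∑ mu ∈ below lam, u lam mu • orbSum S mu) lam.1 (∑ mu ∈ below lam, 0) := by
    refine HasTop.sum fun mu hmu => ?_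
    have h1 := (hasTop_orbSum (S := S) mu).smul (u lam mu)
    refine ⟨fun v hv => (h1.le v hv).trans (mem_below.1 hmu).2, h1.coeff_eq_zero fun hle => ?_⟩
    exact (mem_below.1 hmu).1 (Subtype.ext ((mem_below.1 hmu).2.antisymm hle))
  rw [triSum]
  simpa using (hasTop_orbSum lam).add h

theorem triSum_ne_zero [Nontrivial S] (u : DominantWeight n → DominantWeight n → S)
    (lam : DominantWeight n) : triSum u lam ≠ 0 := by
  intro h
  have := (hasTop_triSum u lam).coeff_top
  rw [h] at this
  simp at this

theorem baseChange_triSum {R : Type*} [CommRing R] (φ : S →+* R)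
    (u : DominantWeight n → DominantWeight n → S) (lam : DominantWeight n) :
    baseChange φ (triSum u lam) = triSum (fun lam mu => φ (u lam mu)) lam := by
  rw [triSum, map_add, map_sum, baseChange_orbSum]
  simp only [baseChange_smul, baseChange_orbSum, triSum]

theorem diffOp_triSum [IsDomain S] [CharZero S] (q : Sˣ) (t : S) {ε : S} (hε : ε ^ 2 = 1)
    {u : DominantWeight n → DominantWeight n → S} {lam : DominantWeight n}
    (h : ∀ mu ∈ below lam, (diffOp q t ε (triSum u lam) -
        eigenvalue q t ε lam.1 • (weylDenom S n * triSum u lam)).coeff (mu.1 + rho n) = 0) :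
    diffOp q t ε (triSum u lam) = eigenvalue q t ε lam.1 • (weylDenom S n * triSum u lam) := by
  have h1 := (hasTop_triSum u lam).diffOp q t ε
  have h2 := ((hasTop_weylDenom (S := S) (n := n)).mul (hasTop_triSum u lam)).smul
    (eigenvalue q t ε lam.1)
  rw [mul_one, mul_one, add_comm (rho n)] at h2
  have h3 := h1.sub h2
  rw [sub_self] at h3
  rw [← sub_eq_zero]
  refine eq_zero_of_antisymmetric (fun σ s => ?_) lam (fun v hv => h3.coeff_eq_zero hv)
    fun mu hmu => ?_
  · rw [map_sub, map_smul, map_mul, weylAlg_diffOp q t hε σ s (isInvariant_triSum u lam),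
      weylAlg_weylDenom, isInvariant_triSum u lam, mul_sub, mul_smul_comm, mul_assoc]
  · by_cases hne : mu = lam
    -- At `lam + ρ` the coefficient vanishes by the choice of the eigenvalue.
    · subst hne; exact h3.coeff_top
    · exact h mu (mem_below.2 ⟨hne, hmu⟩)

end Pairing

/-! ### The eigenvalues -/

section Eigenvalues

variable {n : ℕ}

theorem eigenvalue_eq_sum {S : Type*} [CommRing S] (q : Sˣ) (t : S) {ε : S} (hε : ε ^ 2 = 1)
    (v : Weight n) : eigenvalue q t ε v =
      ∑ i : Fin n, (t ^ (2 * n - 1 - (i : ℕ)) * ((q ^ (v i) : Sˣ) : S) +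
        t ^ (i : ℕ) * ((q ^ (-v i) : Sˣ) : S)) := by
  rw [eigenvalue, Fintype.sum_prod_type]
  refine Finset.sum_congr rfl fun i _ => ?_
  rw [UnitsInt.univ, Finset.sum_pair (by decide)]
  simp [kernelTop, hε]

/-- The eigenvalues increase strictly along the dominance order when `0 < q < 1`. -/
theorem eigenvalue_lt (q : ℝˣ) (hq0 : 0 < (q : ℝ)) (hq1 : (q : ℝ) < 1) (k : ℕ) {ε : ℝ}
    (hε : ε ^ 2 = 1) {lam mu : DominantWeight n} (h : mu ∈ below lam) :
    eigenvalue q ((q : ℝ) ^ k) ε mu.1 < eigenvalue q ((q : ℝ) ^ k) ε lam.1 := by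
  set x : ℝ := (q : ℝ) with hx
  set c : ℝ := -Real.log x with hc
  have hc0 : 0 < c := by
    rw [hc, neg_pos]; exact Real.log_neg hq0 hq1
  have hexp : ∀ m : ℤ, x ^ m = Real.exp (-(m * c)) := by
    intro m
    rw [hc, ← Real.rpow_intCast, Real.rpow_def_of_pos hq0]
    congr 1; ring
  -- the slope of the summand with index `i` at `mu`
  let A : Fin n → ℝ := fun i => (x ^ k) ^ (i : ℕ) * x ^ (-mu.1 i)
  let B : Fin n → ℝ := fun i => (x ^ k) ^ (2 * n - 1 - (i : ℕ)) * x ^ (mu.1 i)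
  have hA : ∀ i, A i = x ^ ((k * (i : ℕ) : ℤ) - mu.1 i) := by
    intro i
    simp only [A]
    rw [← pow_mul, ← zpow_natCast, ← zpow_add₀ hq0.ne']
    congr 1
  have hB : ∀ i, B i = x ^ ((k * (2 * n - 1 - (i : ℕ) : ℕ) : ℤ) + mu.1 i) := by
    intro i
    simp only [B]
    rw [← pow_mul, ← zpow_natCast, ← zpow_add₀ hq0.ne']
    congr 1
  have hA0 : ∀ i, 0 < A i := fun i => by rw [hA]; exact zpow_pos hq0 _
  have hB0 : ∀ i, 0 < B i := fun i => by rw [hB]; exact zpow_pos hq0 _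
  have hmono : ∀ a b : ℤ, a ≤ b → x ^ b ≤ x ^ a := fun a b hab =>
    zpow_le_zpow_right_of_le_one₀ hq0 hq1.le hab
  let D : Fin n → ℝ := fun i => A i - B i
  have hD0 : ∀ i, 0 ≤ D i := by
    intro i
    simp only [D, hA, hB, sub_nonneg]
    apply hmono
    have h1 : (i : ℕ) ≤ 2 * n - 1 - (i : ℕ) := by have := i.2; omega
    have h2 : (k : ℤ) * (i : ℕ) ≤ k * (2 * n - 1 - (i : ℕ) : ℕ) :=
      mul_le_mul_of_nonneg_left (by exact_mod_cast h1) (by positivity)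
    have := mu.2.2 i
    linarith
  have hDanti : ∀ i j, i < j → D j ≤ D i := by
    intro i j hij
    have hij' : (i : ℕ) < j := hij
    have hm := mu.2.1 hij.le
    simp only [D, hA, hB]
    refine sub_le_sub (hmono _ _ ?_) (hmono _ _ ?_)
    · have h2 : (k : ℤ) * (i : ℕ) ≤ k * (j : ℕ) :=
        mul_le_mul_of_nonneg_left (by exact_mod_cast hij'.le) (by positivity)
      linarith
    · have h1 : 2 * n - 1 - (j : ℕ) ≤ 2 * n - 1 - (i : ℕ) := by omega
      have h2 : (k : ℤ) * (2 * n - 1 - (j : ℕ) : ℕ) ≤ k * (2 * n - 1 - (i : ℕ) : ℕ) :=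
        mul_le_mul_of_nonneg_left (by exact_mod_cast h1) (by positivity)
      linarith
  -- The slopes `D` are nonnegative and decreasing, so `D` pairs nonnegatively with every positive
  -- root.
  have hsum : ∀ y ∈ AddSubmonoid.closure (positiveRoots n), 0 ≤ ∑ i, D i * (y i : ℝ) := by
    have heps : ∀ j : Fin n, ∑ i, D i * ((eps j i : ℤ) : ℝ) = D j := by
      intro j
      simp [eps, Pi.single_apply]
    intro y hy
    induction hy using AddSubmonoid.closure_induction with
    | mem y hy =>
      rcases hy with ⟨i, j, hij, rfl | rfl⟩ | ⟨i, rfl⟩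
      · simp only [Pi.sub_apply, Int.cast_sub, mul_sub, Finset.sum_sub_distrib, heps]
        have := hDanti i j hij
        linarith
      · simp only [Pi.add_apply, Int.cast_add, mul_add, Finset.sum_add_distrib, heps]
        exact add_nonneg (hD0 i) (hD0 j)
      · rw [heps]; exact hD0 i
    | zero => simp
    | add y z _ _ hy hz =>
      simp only [Pi.add_apply, Int.cast_add, mul_add, Finset.sum_add_distrib]
      exact add_nonneg hy hz
  have hS := hsum _ (mem_below.1 h).2
  -- the convexity of the summands
  let d : Fin n → ℤ := fun i => lam.1 i - mu.1 i
  have hterm : ∀ i : Fin n, (x ^ k) ^ (2 * n - 1 - (i : ℕ)) * x ^ (lam.1 i) +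
      (x ^ k) ^ (i : ℕ) * x ^ (-lam.1 i) =
        B i * Real.exp (-(d i * c)) + A i * Real.exp (d i * c) := by
    intro i
    have h1 : x ^ (lam.1 i) = x ^ (mu.1 i) * Real.exp (-(d i * c)) := by
      rw [← hexp, ← zpow_add₀ hq0.ne']; congr 1; simp [d]
    have h2 : x ^ (-lam.1 i) = x ^ (-mu.1 i) * Real.exp (d i * c) := by
      have h3 : Real.exp (d i * c) = x ^ (-d i) := by rw [hexp]; push_cast; congr 1; ring
      rw [h3, ← zpow_add₀ hq0.ne']; congr 1; simp only [d]; ring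
    simp only [A, B]
    rw [h1, h2]; ring
  -- The tangent bound `e^y ≥ 1 + y`. Summed over `i`, its linear terms give `c` times the pairing
  -- of `D` with `lam - mu`; strictness comes from a coordinate where the weights differ.
  have hle : ∀ i, B i + A i + c * (D i * ((lam.1 - mu.1) i : ℤ)) ≤
      B i * Real.exp (-(d i * c)) + A i * Real.exp (d i * c) := by
    intro i
    have h1 := mul_le_mul_of_nonneg_left (Real.add_one_le_exp (-(d i * c))) (hB0 i).le
    have h2 := mul_le_mul_of_nonneg_left (Real.add_one_le_exp (d i * c)) (hA0 i).le
    simp only [D, Pi.sub_apply]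
    simp only [d] at h1 h2 ⊢
    nlinarith
  obtain ⟨j, hj⟩ : ∃ j, d j ≠ 0 := by
    by_contra hall
    push Not at hall
    refine (mem_below.1 h).1 (Subtype.ext (funext fun i => ?_))
    have := hall i
    simp only [d] at this
    omega
  have hlt : B j + A j + c * (D j * ((lam.1 - mu.1) j : ℤ)) <
      B j * Real.exp (-(d j * c)) + A j * Real.exp (d j * c) := by
    have hne : (d j : ℝ) * c ≠ 0 := mul_ne_zero (by exact_mod_cast hj) hc0.ne'
    have h1 := mul_lt_mul_of_pos_left (Real.add_one_lt_exp (neg_ne_zero.2 hne)) (hB0 j)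
    have h2 := mul_lt_mul_of_pos_left (Real.add_one_lt_exp hne) (hA0 j)
    simp only [D, Pi.sub_apply]
    simp only [d] at h1 h2 ⊢
    nlinarith
  have hfin := Finset.sum_lt_sum (fun i _ => hle i) ⟨j, Finset.mem_univ j, hlt⟩
  rw [Finset.sum_add_distrib, ← Finset.mul_sum] at hfin
  have hpos := mul_nonneg hc0.le hS
  rw [eigenvalue_eq_sum q _ hε, eigenvalue_eq_sum q _ hε]
  simp only [Units.val_zpow_eq_zpow_val, ← hx]
  rw [Finset.sum_congr rfl fun i _ => hterm i]
  have hAB : ∑ i : Fin n, ((x ^ k) ^ (2 * n - 1 - (i : ℕ)) * x ^ (mu.1 i) +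
      (x ^ k) ^ (i : ℕ) * x ^ (-mu.1 i)) = ∑ i, (B i + A i) := rfl
  rw [hAB]
  linarith

/-- The exponents of the eigenvalue of a weight as a sum of powers of `q`, for `t = q ^ k`. -/
def eigenExponent (k : ℕ) (v : Weight n) (p : Fin n × ℤˣ) : ℤ :=
  if p.2 = 1 then k * (2 * n - 1 - (p.1 : ℕ) : ℕ) + v p.1 else k * (p.1 : ℕ) - v p.1

theorem eigenvalue_eq_sum_zpow {S : Type*} [CommRing S] (q : Sˣ) (k : ℕ) {ε : S} (hε : ε ^ 2 = 1)
    (v : Weight n) : eigenvalue q ((q : S) ^ k) ε v =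
      ∑ p : Fin n × ℤˣ, ((q ^ eigenExponent k v p : Sˣ) : S) := by
  refine Finset.sum_congr rfl fun p _ => ?_
  have h : ∀ m : ℕ, ((q : S) ^ k) ^ m = ((q ^ ((k * m : ℕ) : ℤ) : Sˣ) : S) := fun m => by
    rw [zpow_natCast, Units.val_pow_eq_pow_val, pow_mul]
  unfold kernelTop eigenExponent
  split_ifs with hp
  · rw [hε, one_mul, h, ← Units.val_mul, ← zpow_add, hp]
    simp
  · rw [h, ← Units.val_mul, ← zpow_add, (Int.units_eq_one_or p.2).resolve_left hp]
    simp [sub_eq_add_neg]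

/-- If `lam i > mu i`, let `c` be the exponent of `lam` at `(i, 1)`. All exponents of `mu` with
index `≥ i` lie below `c`, and those with index `< i` agree with the ones of `lam`, so `lam` attains
`c` more often than `mu`. -/
theorem le_of_card_eigenExponent_eq (k : ℕ) {lam mu : DominantWeight n}
    (h : ∀ c : ℤ, (Finset.univ.filter fun p => eigenExponent k lam.1 p = c).card =
      (Finset.univ.filter fun p => eigenExponent k mu.1 p = c).card)
    (i : Fin n) (hi : ∀ j < i, lam.1 j = mu.1 j) : lam.1 i ≤ mu.1 i := by
  by_contra hlt
  rw [not_le] at hlt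
  refine (Finset.card_lt_card (Finset.ssubset_iff_of_subset ?_ |>.2 ?_)).ne
    (h (eigenExponent k lam.1 (i, 1))).symm
  · rintro ⟨j, u⟩ hp
    rw [Finset.mem_filter] at hp ⊢
    refine ⟨hp.1, ?_⟩
    by_cases hj : j < i
    · rw [← hp.2]
      simp only [eigenExponent, hi j hj]
    · exfalso
      have hij : (i : ℕ) ≤ j := not_lt.1 hj
      have hjn := j.2
      have hp2 := hp.2
      have hm : mu.1 j ≤ mu.1 i := mu.2.1 (not_lt.1 hj)
      have hm0 := mu.2.2 j
      have hm1 := mu.2.2 i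
      simp only [eigenExponent, if_true] at hp2
      split_ifs at hp2 with hu
      · have h1 : 2 * n - 1 - (j : ℕ) ≤ 2 * n - 1 - (i : ℕ) := by omega
        have h2 : (k : ℤ) * (2 * n - 1 - (j : ℕ) : ℕ) ≤ k * (2 * n - 1 - (i : ℕ) : ℕ) :=
          mul_le_mul_of_nonneg_left (by exact_mod_cast h1) (by positivity)
        linarith
      · have h1 : (j : ℕ) ≤ 2 * n - 1 - (i : ℕ) := by omega
        have h2 : (k : ℤ) * (j : ℕ) ≤ k * (2 * n - 1 - (i : ℕ) : ℕ) :=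
          mul_le_mul_of_nonneg_left (by exact_mod_cast h1) (by positivity)
        linarith
  · refine ⟨(i, 1), by simp, ?_⟩
    simp only [Finset.mem_filter, Finset.mem_univ, true_and, eigenExponent, if_true]
    intro h'
    linarith

theorem eq_of_card_eigenExponent_eq (k : ℕ) {lam mu : DominantWeight n}
    (h : ∀ c : ℤ, (Finset.univ.filter fun p => eigenExponent k lam.1 p = c).card =
      (Finset.univ.filter fun p => eigenExponent k mu.1 p = c).card) : lam = mu := by
  refine Subtype.ext (funext fun i => ?_)
  induction i using WellFoundedLT.induction with
  | ind i ih =>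
    exact le_antisymm (le_of_card_eigenExponent_eq k h i ih)
      (le_of_card_eigenExponent_eq k (fun c => (h c).symm) i fun j hj => (ih j hj).symm)

end Eigenvalues

/-! ### The rings of generic coefficients -/

section Generic

open Polynomial

/-- The polynomials in `q`, `t`, `ε` without zeros at `(x, x ^ k, ±1)` for real `0 < x < 1`. -/
def regular3 : Submonoid (MvPolynomial (Fin 3) ℤ) where
  carrier := {p | ∀ x : ℝ, 0 < x → x < 1 → ∀ k : ℕ, ∀ e : ℝ, e ^ 2 = 1 →
    MvPolynomial.aeval ![x, x ^ k, e] p ≠ 0}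
  one_mem' := fun x _ _ k e _ => by simp
  mul_mem' := fun {p p'} hp hp' x h0 h1 k e he => by
    rw [map_mul]
    exact mul_ne_zero (hp x h0 h1 k e he) (hp' x h0 h1 k e he)

/-- The integral polynomials without real zeros between `0` and `1`. -/
def regular1 : Submonoid ℤ[X] where
  carrier := {p | ∀ x : ℝ, 0 < x → x < 1 → aeval x p ≠ 0}
  one_mem' := fun x _ _ => by simp
  mul_mem' := fun {p p'} hp hp' x h0 h1 => by
    rw [map_mul]
    exact mul_ne_zero (hp x h0 h1) (hp' x h0 h1)

/-- The rational functions in `q`, `t`, `ε` that are regular at `(x, x ^ k, ±1)` for real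
`0 < x < 1`. -/
abbrev Generic3 := Localization regular3

/-- The rational functions in `q` that are regular between `0` and `1`. -/
abbrev Generic1 := Localization regular1

theorem regular1_le : regular1 ≤ nonZeroDivisors ℤ[X] := by
  intro p hp
  refine mem_nonZeroDivisors_of_ne_zero ?_
  rintro rfl
  exact hp (1 / 2) (by norm_num) (by norm_num) (by simp)

instance : IsDomain Generic1 := IsLocalization.isDomain_localization regular1_le

theorem algebraMap_generic1_injective : Function.Injective (algebraMap ℤ[X] Generic1) :=
  IsLocalization.injective Generic1 regular1_le

instance : CharZero Generic1 :=
  charZero_of_injective_algebraMap algebraMap_generic1_injective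

theorem aeval_aeval_powers {K : Type*} [CommRing K] (x : K) (k : ℕ) (e : ℤ)
    (p : MvPolynomial (Fin 3) ℤ) :
    aeval x (MvPolynomial.aeval ![(X : ℤ[X]), X ^ k, C e] p) =
      MvPolynomial.aeval ![x, x ^ k, (e : K)] p := by
  have h : ((aeval x : ℤ[X] →ₐ[ℤ] K).comp (MvPolynomial.aeval ![(X : ℤ[X]), X ^ k, C e])) =
      MvPolynomial.aeval ![x, x ^ k, (e : K)] := by
    refine MvPolynomial.algHom_ext fun i => ?_
    fin_cases i <;> simp
  exact DFunLike.congr_fun h p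

/-- The specialization `t = q ^ k`, `ε = e`. -/
def specialize (k : ℕ) (e : ℤ) (he : e ^ 2 = 1) : Generic3 →+* Generic1 :=
  IsLocalization.lift (M := regular3) (g := (algebraMap ℤ[X] Generic1).comp
    (MvPolynomial.aeval ![(X : ℤ[X]), X ^ k, C e] : MvPolynomial (Fin 3) ℤ →ₐ[ℤ] ℤ[X]).toRingHom)
    fun p => by
      refine IsLocalization.map_units Generic1 (⟨_, fun x h0 h1 => ?_⟩ : regular1)
      have h := p.2 x h0 h1 k (e : ℝ) (by exact_mod_cast he)
      rw [← aeval_aeval_powers] at h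
      exact h

theorem specialize_algebraMap (k : ℕ) (e : ℤ) (he : e ^ 2 = 1) (p : MvPolynomial (Fin 3) ℤ) :
    specialize k e he (algebraMap (MvPolynomial (Fin 3) ℤ) Generic3 p) =
      algebraMap ℤ[X] Generic1 (MvPolynomial.aeval ![(X : ℤ[X]), X ^ k, C e] p) :=
  IsLocalization.lift_eq _ _

/-- The value at `x` of a rational function. -/
def evalAt {K : Type*} [CommRing K] (x : K) (hx : ∀ p ∈ regular1, IsUnit (aeval x p)) :
    Generic1 →+* K :=
  IsLocalization.lift (M := regular1) (g := (aeval x : ℤ[X] →ₐ[ℤ] K).toRingHom)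
    fun p => hx p.1 p.2

theorem evalAt_algebraMap {K : Type*} [CommRing K] (x : K)
    (hx : ∀ p ∈ regular1, IsUnit (aeval x p)) (p : ℤ[X]) :
    evalAt x hx (algebraMap ℤ[X] Generic1 p) = aeval x p :=
  IsLocalization.lift_eq _ _

theorem evalAt_specialize {K : Type*} [CommRing K] (x : K)
    (hx : ∀ p ∈ regular1, IsUnit (aeval x p)) (k : ℕ) (e : ℤ) (he : e ^ 2 = 1)
    (p : MvPolynomial (Fin 3) ℤ) :
    evalAt x hx (specialize k e he (algebraMap (MvPolynomial (Fin 3) ℤ) Generic3 p)) =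
      MvPolynomial.aeval ![x, x ^ k, (e : K)] p := by
  rw [specialize_algebraMap, evalAt_algebraMap, aeval_aeval_powers]

/-- The value of a rational function at a real number between `0` and `1`. -/
def evalReal (x : ℝ) (h0 : 0 < x) (h1 : x < 1) : Generic1 →+* ℝ :=
  evalAt x fun _ hp => (hp x h0 h1).isUnit

/-- A fraction without zeros in the interval has its numerator in the localized monoid, so it is
inverted as well. -/
theorem isUnit_generic1 {z : Generic1} (hz : ∀ x h0 h1, evalReal x h0 h1 z ≠ 0) : IsUnit z := by
  obtain ⟨p, d, rfl⟩ := IsLocalization.exists_mk'_eq regular1 z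
  have hp : p ∈ regular1 := fun x h0 h1 => by
    rw [← evalAt_algebraMap x (fun _ hp => (hp x h0 h1).isUnit) p,
      ← IsLocalization.mk'_spec Generic1 p d, map_mul]
    refine mul_ne_zero (hz x h0 h1) ?_
    rw [evalAt_algebraMap]
    exact d.2 x h0 h1
  exact IsUnit.of_mul_eq_one _ (IsLocalization.mk'_mul_mk'_eq_one' p d hp)

theorem isUnit_generic3 {z : Generic3}
    (hz : ∀ x h0 h1 k e he, evalReal x h0 h1 (specialize k e he z) ≠ 0) : IsUnit z := by
  obtain ⟨p, d, rfl⟩ := IsLocalization.exists_mk'_eq regular3 z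
  have hp : p ∈ regular3 := fun x h0 h1 k e he => by
    obtain ⟨e, rfl⟩ : ∃ e' : ℤ, (e' : ℝ) = e := by
      rcases sq_eq_one_iff.1 he with rfl | rfl
      · exact ⟨1, by simp⟩
      · exact ⟨-1, by simp⟩
    have he' : e ^ 2 = 1 := by exact_mod_cast he
    have hx : ∀ p ∈ regular1, IsUnit (aeval x p) := fun _ hp => (hp x h0 h1).isUnit
    rw [← evalAt_specialize x hx k e he' p, ← IsLocalization.mk'_spec Generic3 p d, map_mul,
      map_mul]
    refine mul_ne_zero (hz x h0 h1 k e he') ?_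
    rw [evalAt_specialize]
    exact d.2 x h0 h1 k e he
  exact IsUnit.of_mul_eq_one _ (IsLocalization.mk'_mul_mk'_eq_one' p d hp)

/-- The parameter `q` as a unit of the ring of rational functions in `q`, `t`, `ε`. -/
def q3 : Generic3ˣ :=
  (IsLocalization.map_units Generic3 (⟨MvPolynomial.X 0, fun x h0 _ k e _ => by
    simpa using h0.ne'⟩ : regular3)).unit

/-- The parameter `q` as a unit of the ring of rational functions in `q`. -/
def q1 : Generic1ˣ :=
  (IsLocalization.map_units Generic1 (⟨X, fun x h0 _ => by simpa using h0.ne'⟩ : regular1)).unit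

theorem coe_q1 : (q1 : Generic1) = algebraMap ℤ[X] Generic1 X := rfl

/-- The parameter `t` in the ring of rational functions in `q`, `t`, `ε`. -/
def t3 : Generic3 := algebraMap (MvPolynomial (Fin 3) ℤ) Generic3 (MvPolynomial.X 1)

/-- The parameter `ε` in the ring of rational functions in `q`, `t`, `ε`. -/
def e3 : Generic3 := algebraMap (MvPolynomial (Fin 3) ℤ) Generic3 (MvPolynomial.X 2)

theorem specialize_q3 (k : ℕ) (e : ℤ) (he : e ^ 2 = 1) :
    Units.map (specialize k e he : Generic3 →* Generic1) q3 = q1 := by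
  ext
  change specialize k e he (algebraMap (MvPolynomial (Fin 3) ℤ) Generic3 (MvPolynomial.X 0)) =
    algebraMap ℤ[X] Generic1 X
  rw [specialize_algebraMap]
  simp

theorem specialize_t3 (k : ℕ) (e : ℤ) (he : e ^ 2 = 1) :
    specialize k e he t3 = (q1 : Generic1) ^ k := by
  rw [t3, specialize_algebraMap, coe_q1, ← map_pow]
  simp

theorem specialize_e3 (k : ℕ) (e : ℤ) (he : e ^ 2 = 1) :
    specialize k e he e3 = (e : Generic1) := by
  rw [e3, specialize_algebraMap]
  simp

theorem evalAt_q1 {K : Type*} [CommRing K] (x : K) (hx : ∀ p ∈ regular1, IsUnit (aeval x p)) :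
    evalAt x hx q1 = x := by
  rw [coe_q1, evalAt_algebraMap, aeval_X]

theorem evalReal_q1 (x : ℝ) (h0 : 0 < x) (h1 : x < 1) : evalReal x h0 h1 q1 = x :=
  evalAt_q1 x _

theorem specialize_eigenvalue {n : ℕ} (k : ℕ) (e : ℤ) (he : e ^ 2 = 1) (v : Weight n) :
    specialize k e he (eigenvalue q3 t3 e3 v) =
      eigenvalue q1 ((q1 : Generic1) ^ k) (e : Generic1) v := by
  rw [map_eigenvalue, specialize_q3, specialize_t3, specialize_e3]

theorem isUnit_eigenvalue_sub {n : ℕ} {lam mu : DominantWeight n} (h : mu ∈ below lam) :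
    IsUnit (eigenvalue q3 t3 e3 mu.1 - eigenvalue q3 t3 e3 lam.1) := by
  refine isUnit_generic3 fun x h0 h1 k e he => ?_
  have hq : ((Units.map (evalReal x h0 h1 : Generic1 →* ℝ) q1 : ℝˣ) : ℝ) = x :=
    evalReal_q1 x h0 h1
  rw [map_sub, map_sub, specialize_eigenvalue, specialize_eigenvalue, map_eigenvalue,
    map_eigenvalue, map_pow, map_intCast, evalReal_q1, sub_ne_zero]
  have := eigenvalue_lt (Units.map (evalReal x h0 h1 : Generic1 →* ℝ) q1) (by rwa [hq])
    (by rwa [hq]) k (ε := (e : ℝ)) (by exact_mod_cast he) h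
  rw [hq] at this
  exact this.ne

theorem eigenvalue_ne {n : ℕ} (k : ℕ) {e : ℤ} (he : e ^ 2 = 1) {lam mu : DominantWeight n}
    (h : lam ≠ mu) : eigenvalue q1 ((q1 : Generic1) ^ k) (e : Generic1) lam.1 ≠
      eigenvalue q1 ((q1 : Generic1) ^ k) (e : Generic1) mu.1 := by
  have he' : (e : Generic1) ^ 2 = 1 := by exact_mod_cast he
  rw [eigenvalue_eq_sum_zpow q1 k he', eigenvalue_eq_sum_zpow q1 k he']
  intro heq
  refine h (eq_of_card_eigenExponent_eq k fun c => ?_)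
  -- Multiplying by `q^N` for a large `N` turns the Laurent polynomials in `q` into polynomials,
  -- whose coefficients count the exponents.
  obtain ⟨N, hN⟩ : ∃ N : ℕ, (0 ≤ N + c) ∧ (∀ p, 0 ≤ N + eigenExponent k lam.1 p) ∧
      ∀ p, 0 ≤ N + eigenExponent k mu.1 p := by
    refine ⟨(|c| + ∑ p, |eigenExponent k lam.1 p| + ∑ p, |eigenExponent k mu.1 p|).toNat, ?_⟩
    rw [Int.toNat_of_nonneg (by positivity)]
    have h1 : ∀ f : Fin n × ℤˣ → ℤ, 0 ≤ ∑ p, |f p| := fun f => by positivity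
    have h2 : ∀ (f : Fin n × ℤˣ → ℤ) p, |f p| ≤ ∑ p, |f p| := fun f p =>
      Finset.single_le_sum (f := fun p => |f p|) (fun _ _ => abs_nonneg _) (Finset.mem_univ p)
    have h3 := h1 (eigenExponent k lam.1)
    have h4 := h1 (eigenExponent k mu.1)
    have h5 := abs_nonneg c
    refine ⟨?_, fun p => ?_, fun p => ?_⟩
    · have := neg_abs_le c; linarith
    · have := h2 (eigenExponent k lam.1) p
      have := neg_abs_le (eigenExponent k lam.1 p); linarith
    · have := h2 (eigenExponent k mu.1) p
      have := neg_abs_le (eigenExponent k mu.1 p); linarith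
  have key : ∀ v : Weight n, (∀ p, 0 ≤ N + eigenExponent k v p) →
      (q1 : Generic1) ^ N * ∑ p : Fin n × ℤˣ, ((q1 ^ eigenExponent k v p : Generic1ˣ) : Generic1) =
        algebraMap ℤ[X] Generic1 (∑ p, X ^ (N + eigenExponent k v p).toNat) := by
    intro v hv
    rw [map_sum, Finset.mul_sum]
    refine Finset.sum_congr rfl fun p _ => ?_
    rw [map_pow, ← coe_q1, ← Units.val_pow_eq_pow_val, ← Units.val_pow_eq_pow_val, ← Units.val_mul,
      ← zpow_natCast, ← zpow_natCast, ← zpow_add, Int.toNat_of_nonneg (hv p)]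
  have hpoly := algebraMap_generic1_injective
    ((key lam.1 hN.2.1).symm.trans ((congrArg _ heq).trans (key mu.1 hN.2.2)))
  have hcoeff : ∀ v : Weight n, (∀ p, 0 ≤ N + eigenExponent k v p) →
      (∑ p, X ^ (N + eigenExponent k v p).toNat : ℤ[X]).coeff (N + c).toNat =
        (Finset.univ.filter fun p => eigenExponent k v p = c).card := by
    intro v hv
    rw [finsetSum_coeff, Finset.card_filter, Nat.cast_sum]
    refine Finset.sum_congr rfl fun p _ => ?_
    rw [coeff_X_pow]
    have := hv p
    have := hN.1
    split_ifs <;> first | rfl | omega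
  have h1 := hcoeff lam.1 hN.2.1
  rw [hpoly, hcoeff mu.1 hN.2.2] at h1
  exact_mod_cast h1.symm

/-- Orthogonal polynomials with coefficients in the rational functions in `q`, `t`, `ε`. -/
theorem exists_generic_coefficients (n : ℕ) :
    ∃ u : DominantWeight n → DominantWeight n → Generic3,
      ∀ (k : ℕ) (e : ℤ) (he : e ^ 2 = 1),
        (∀ lam mu, lam ≠ mu → pair (q1 : Generic1) (e : Generic1) k
          (triSum (fun lam mu => specialize k e he (u lam mu)) lam)
          (triSum (fun lam mu => specialize k e he (u lam mu)) mu) = 0) ∧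
        ∀ lam, IsUnit (pair (q1 : Generic1) (e : Generic1) k
          (triSum (fun lam mu => specialize k e he (u lam mu)) lam)
          (triSum (fun lam mu => specialize k e he (u lam mu)) lam)) := by
  obtain ⟨u, hu⟩ := exists_coeff_eq_zero (n := n) q3 t3 e3 fun lam mu h => isUnit_eigenvalue_sub h
  refine ⟨u, fun k e he => ⟨fun lam mu hne => ?_, fun lam => ?_⟩⟩
  · have he' : (e : Generic1) ^ 2 = 1 := by exact_mod_cast he
    have heig : ∀ lam : DominantWeight n, diffOp q1 ((q1 : Generic1) ^ k) (e : Generic1)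
        (triSum (fun lam mu => specialize k e he (u lam mu)) lam) =
          eigenvalue q1 ((q1 : Generic1) ^ k) (e : Generic1) lam.1 • (weylDenom Generic1 n *
            triSum (fun lam mu => specialize k e he (u lam mu)) lam) := by
      intro lam
      -- Here `ε = ±1`, so antisymmetry is available and the imposed coefficients give the full
      -- eigenvector equation.
      refine diffOp_triSum q1 _ he' fun mu hmu => ?_
      have h1 := congrArg (specialize k e he) (hu lam mu hmu)
      rw [map_zero, ← AddMonoidAlgebra.coeff_mapRingHom, map_sub, baseChange_diffOp,
        baseChange_smul, map_mul, baseChange_weylDenom, baseChange_triSum, specialize_q3,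
        specialize_t3, specialize_e3, specialize_eigenvalue] at h1
      exact h1
    exact pair_eq_zero_of_eigenvalue_ne q1 he' k (isInvariant_triSum _ _) (heig lam) (heig mu)
      (eigenvalue_ne k he hne)
  -- Evaluation at a real `x` turns the norm into a positive number, so it has no zero in the
  -- interval.
  · refine isUnit_generic1 fun x h0 h1 => ?_
    rw [map_pair, baseChange_triSum]
    exact (pair_self_pos _ _ _ (triSum_ne_zero _ _)).ne'

end Generic

/-! ### Bases of the invariants -/

section Field

variable {K : Type*} [Field K] {n : ℕ}

theorem mem_span_orbSum {f : Laurent K n} (hf : IsInvariant f) :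
    f ∈ Submodule.span K (Set.range (orbSum K (n := n))) := by
  classical
  let T : Finset (DominantWeight n) := f.coeff.support.subtype _
  have h : f = ∑ mu ∈ T, f.coeff mu.1 • orbSum K mu := by
    ext v
    obtain ⟨σ, s, h1, h2⟩ := exists_weylAct_dominant v
    let lam : DominantWeight n := ⟨weylAct σ s v, h1, h2⟩
    have hlam : f.coeff lam.1 = f.coeff v := hf.coeff_weylAct σ s v
    have hv : v ∈ orbit lam.1 := by
      rw [← weylAct_mem_orbit_iff σ s]
      exact self_mem_orbit lam.1
    rw [AddMonoidAlgebra.coeff_sum, Finsupp.finsetSum_apply, Finset.sum_eq_single lam]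
    · rw [AddMonoidAlgebra.coeff_smul, Finsupp.smul_apply, coeff_orbSum, if_pos hv, hlam,
        smul_eq_mul, mul_one]
    · intro mu _ hne
      rw [AddMonoidAlgebra.coeff_smul, Finsupp.smul_apply, coeff_orbSum, if_neg, smul_zero]
      intro hmu
      rw [← weylAct_mem_orbit_iff σ s] at hmu
      exact hne (eq_of_mem_orbit (lam := mu) (mu := lam) hmu).symm
    · intro hT
      have h0 : f.coeff lam.1 = 0 := by
        by_contra h0
        exact hT (Finset.mem_subtype.2 (Finsupp.mem_support_iff.2 h0))
      rw [h0, zero_smul]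
      rfl
  rw [h]
  exact Submodule.sum_mem _ fun mu _ => Submodule.smul_mem _ _ (Submodule.subset_span ⟨mu, rfl⟩)

/-- Inverts a triangular system while keeping track of the support: only weights `≤ lam` are used,
which the uniqueness argument needs. -/
theorem orbSum_mem_span {G : DominantWeight n → Laurent K n} {c : DominantWeight n → K}
    {v : DominantWeight n → DominantWeight n → K} (hc : ∀ lam, c lam ≠ 0)
    (hG : ∀ lam, G lam = c lam • orbSum K lam + ∑ mu ∈ below lam, v lam mu • orbSum K mu)
    (lam : DominantWeight n) :
    orbSum K lam ∈ Submodule.span K (G '' {nu | nu = lam ∨ nu ∈ below lam}) := by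
  induction lam using below_induction with
  | h lam ih =>
    have h1 : orbSum K lam = (c lam)⁻¹ • (G lam - ∑ mu ∈ below lam, v lam mu • orbSum K mu) := by
      rw [hG, add_sub_cancel_right, inv_smul_smul₀ (hc lam)]
    rw [h1]
    refine Submodule.smul_mem _ _ (Submodule.sub_mem _
      (Submodule.subset_span ⟨lam, Or.inl rfl, rfl⟩) (Submodule.sum_mem _ fun mu hmu =>
        Submodule.smul_mem _ _ (Submodule.span_mono (Set.image_mono ?_) (ih mu hmu))))
    rintro nu (rfl | hnu)
    · exact Or.inr hmu
    · exact Or.inr (mem_below_trans hnu hmu)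

theorem span_triSum (u : DominantWeight n → DominantWeight n → K) :
    Submodule.span K (Set.range (triSum u)) = invariants K n := by
  refine le_antisymm (Submodule.span_le.2 ?_) fun f hf => ?_
  · rintro _ ⟨lam, rfl⟩
    exact isInvariant_triSum u lam
  · refine Submodule.span_le.2 ?_ (mem_span_orbSum hf)
    rintro _ ⟨lam, rfl⟩
    refine Submodule.span_mono (Set.image_subset_range _ _)
      (orbSum_mem_span (c := fun _ => 1) (v := u) (fun _ => one_ne_zero) (fun lam => ?_) lam)
    rw [one_smul, triSum]

theorem linearIndependent_triSum (q ε : K) (k : ℕ) (u : DominantWeight n → DominantWeight n → K)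
    (horth : ∀ lam mu, lam ≠ mu → pair q ε k (triSum u lam) (triSum u mu) = 0)
    (hnorm : ∀ lam, pair q ε k (triSum u lam) (triSum u lam) ≠ 0) :
    LinearIndependent K (triSum u) :=
  LinearMap.BilinForm.linearIndependent_of_iIsOrtho (B := pairForm q ε k)
    (fun lam mu h => horth lam mu h) hnorm

/-- Both families are triangular, so `G lam` is orthogonal to every `m_mu` and every `F_mu` with `mu
< lam`. The difference `G lam - c lam • F_lam` lies in the span of these `F_mu` and is orthogonal to
each; as their norms are nonzero, it vanishes. -/
theorem eq_smul_triSum (q ε : K) (k : ℕ) (u : DominantWeight n → DominantWeight n → K)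
    (horth : ∀ lam mu, lam ≠ mu → pair q ε k (triSum u lam) (triSum u mu) = 0)
    (hnorm : ∀ lam, pair q ε k (triSum u lam) (triSum u lam) ≠ 0)
    {G : DominantWeight n → Laurent K n} {c : DominantWeight n → K}
    {v : DominantWeight n → DominantWeight n → K} (hc : ∀ lam, c lam ≠ 0)
    (hG : ∀ lam, G lam = c lam • orbSum K lam + ∑ mu ∈ below lam, v lam mu • orbSum K mu)
    (hGorth : ∀ lam mu, lam ≠ mu → pair q ε k (G lam) (G mu) = 0) (lam : DominantWeight n) :
    G lam = c lam • triSum u lam := by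
  have hF : ∀ lam, triSum u lam =
      (1 : K) • orbSum K lam + ∑ mu ∈ below lam, u lam mu • orbSum K mu := fun lam => by
    rw [one_smul, triSum]
  have hGm : ∀ mu ∈ below lam, pairForm q ε k (G lam) (orbSum K mu) = 0 := by
    intro mu hmu
    have hle : Submodule.span K (G '' {nu | nu = mu ∨ nu ∈ below mu}) ≤
        LinearMap.ker (pairForm q ε k (G lam)) := by
      refine Submodule.span_le.2 ?_
      rintro _ ⟨nu, hnu, rfl⟩
      have hnu' : nu ∈ below lam := hnu.elim (fun h => h ▸ hmu) fun h => mem_below_trans h hmu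
      exact hGorth lam nu (mem_below.1 hnu').1.symm
    exact hle (orbSum_mem_span hc hG mu)
  have hGF : ∀ mu ∈ below lam, pairForm q ε k (G lam) (triSum u mu) = 0 := by
    intro mu hmu
    rw [triSum, map_add, map_sum, hGm mu hmu, zero_add]
    refine Finset.sum_eq_zero fun nu hnu => ?_
    rw [map_smul, hGm nu (mem_below_trans hnu hmu), smul_zero]
  have hD : G lam - c lam • triSum u lam ∈ Submodule.span K (triSum u '' (below lam : Set _)) := by
    have h1 : G lam - c lam • triSum u lam =
        ∑ mu ∈ below lam, (v lam mu • orbSum K mu - c lam • u lam mu • orbSum K mu) := by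
      rw [hG, triSum, smul_add, Finset.smul_sum, Finset.sum_sub_distrib]
      abel
    rw [h1]
    have h2 : ∀ mu ∈ below lam, orbSum K mu ∈
        Submodule.span K (triSum u '' (below lam : Set _)) := fun mu hmu => by
      refine Submodule.span_mono (Set.image_mono ?_)
        (orbSum_mem_span (c := fun _ => 1) (fun _ => one_ne_zero) hF mu)
      rintro nu (rfl | hnu)
      · exact hmu
      · exact mem_below_trans hnu hmu
    exact Submodule.sum_mem _ fun mu hmu => Submodule.sub_mem _
      (Submodule.smul_mem _ _ (h2 mu hmu))
      (Submodule.smul_mem _ _ (Submodule.smul_mem _ _ (h2 mu hmu)))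
  obtain ⟨a, ha⟩ := (Submodule.mem_span_image_finset_iff_exists_fun' K).1 hD
  have ha0 : ∀ mu ∈ below lam, a mu = 0 := by
    intro mu hmu
    have h1 : pairForm q ε k (G lam - c lam • triSum u lam) (triSum u mu) = 0 := by
      rw [map_sub, map_smul, LinearMap.sub_apply, LinearMap.smul_apply, hGF mu hmu,
        pairForm_apply, horth lam mu (mem_below.1 hmu).1.symm, smul_zero, sub_zero]
    rw [← ha, map_sum, LinearMap.sum_apply, Finset.sum_eq_single mu] at h1
    · rw [map_smul, LinearMap.smul_apply, pairForm_apply, smul_eq_mul] at h1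
      exact (mul_eq_zero.1 h1).resolve_right (hnorm mu)
    · intro nu _ hne
      rw [map_smul, LinearMap.smul_apply, pairForm_apply, horth nu mu hne, smul_zero]
    · exact fun h => absurd hmu h
  rw [← sub_eq_zero, ← ha]
  exact Finset.sum_eq_zero fun mu hmu => by rw [ha0 mu hmu, zero_smul]

open Polynomial in
theorem Admissible.isUnit_aeval [Algebra ℂ K] {q : K} (hq : Admissible q) {p : ℤ[X]}
    (hp : p ∈ regular1) : IsUnit (aeval q p) := by
  rw [isUnit_iff_ne_zero]
  rcases hq with hq | ⟨x, h0, h1, rfl⟩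
  · intro h
    obtain rfl := transcendental_iff.1 hq p h
    -- The zero polynomial is not in `regular1`, as any point of the interval shows.
    exact hp (1 / 2) (by norm_num) (by norm_num) (by simp)
  · have h2 : aeval (algebraMap ℂ K (x : ℂ)) p = algebraMap ℂ K ((aeval x p : ℝ) : ℂ) := by
      rw [aeval_def, aeval_def, ← Complex.ofRealHom_eq_coe, ← Complex.ofRealHom_eq_coe,
        hom_eval₂, hom_eval₂]
      congr 1
      exact RingHom.ext_int _ _
    rw [h2]
    intro h3
    have h4 := (map_eq_zero (algebraMap ℂ K)).1 h3
    exact hp x h0 h1 (by exact_mod_cast h4)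

end Field

end OrthoB

end

/-! ### Specialization of the generic coefficients to `K` -/

theorem theorem4p2 (n : ℕ) :
    -- the coefficients `u lam mu = num lam mu / den lam mu`, rational functions of `q`, `t`, `ε`
    ∃ num den : OrthoB.DominantWeight n → OrthoB.DominantWeight n → MvPolynomial (Fin 3) ℤ,
      ∀ (K : Type*) [Field K] [Algebra ℂ K] (q ε : K) (k : ℕ),
        OrthoB.Admissible q → ε ^ 2 = 1 →
          (∀ lam, ∀ mu ∈ OrthoB.below lam, OrthoB.evalQT q ε k (den lam mu) ≠ 0) ∧
          ∃ F : OrthoB.DominantWeight n → OrthoB.GroupAlg K n,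
            -- triangularity
            (∀ lam, F lam = OrthoB.orbitSum K lam +
              ∑ mu ∈ OrthoB.below lam,
                (OrthoB.evalQT q ε k (num lam mu) / OrthoB.evalQT q ε k (den lam mu)) •
                  OrthoB.orbitSum K mu) ∧
            -- the `F lam` form a basis of `A^W`
            LinearIndependent K F ∧
            Submodule.span K (Set.range F) = OrthoB.invariants K n ∧
            -- orthogonality
            (∀ lam mu, lam ≠ mu → OrthoB.pairing q ε k (F lam) (F mu) = 0) ∧
            -- uniqueness up to constant factors
            (∀ (G : OrthoB.DominantWeight n → OrthoB.GroupAlg K n)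
              (c : OrthoB.DominantWeight n → K)
              (v : OrthoB.DominantWeight n → OrthoB.DominantWeight n → K),
              (∀ lam, c lam ≠ 0) →
              (∀ lam, G lam = c lam • OrthoB.orbitSum K lam +
                ∑ mu ∈ OrthoB.below lam, v lam mu • OrthoB.orbitSum K mu) →
              (∀ lam mu, lam ≠ mu → OrthoB.pairing q ε k (G lam) (G mu) = 0) →
              ∀ lam, ∃ C : K, C ≠ 0 ∧ G lam = C • F lam) := by
  obtain ⟨u, hu⟩ := OrthoB.exists_generic_coefficients n
  choose num den hnd using fun lam mu => IsLocalization.exists_mk'_eq OrthoB.regular3 (u lam mu)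
  refine ⟨num, fun lam mu => (den lam mu).1, ?_⟩
  intro K _ _ q ε k hq hε
  obtain ⟨e, he, rfl⟩ : ∃ e : ℤ, e ^ 2 = 1 ∧ (e : K) = ε := by
    rcases sq_eq_one_iff.1 hε with rfl | rfl
    · exact ⟨1, by simp⟩
    · exact ⟨-1, by simp⟩
  have hx : ∀ p ∈ OrthoB.regular1, IsUnit (Polynomial.aeval q p) := fun p hp =>
    hq.isUnit_aeval hp
  let θ := OrthoB.evalAt q hx
  -- The evaluation at `(q, q^k, ε)` factors through the rational functions in `q` alone, where
  -- orthogonality and the invertibility of the norms are known.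
  let φ : OrthoB.Generic3 →+* K := θ.comp (OrthoB.specialize k e he)
  have hφ : ∀ p, OrthoB.evalQT q (e : K) k p =
      φ (algebraMap (MvPolynomial (Fin 3) ℤ) OrthoB.Generic3 p) := fun p =>
    (OrthoB.evalAt_specialize q hx k e he p).symm
  have hden : ∀ lam mu, OrthoB.evalQT q (e : K) k (den lam mu).1 ≠ 0 := fun lam mu => by
    rw [hφ]
    exact ((IsLocalization.map_units OrthoB.Generic3 (den lam mu)).map φ).ne_zero
  have hdiv : ∀ lam mu, OrthoB.evalQT q (e : K) k (num lam mu) /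
      OrthoB.evalQT q (e : K) k (den lam mu).1 = φ (u lam mu) := fun lam mu => by
    rw [div_eq_iff (hden lam mu), hφ, hφ, ← map_mul, ← hnd, IsLocalization.mk'_spec]
  have hpair : ∀ lam mu, OrthoB.pair q (e : K) k (OrthoB.triSum (fun lam mu => φ (u lam mu)) lam)
      (OrthoB.triSum (fun lam mu => φ (u lam mu)) mu) =
      θ (OrthoB.pair (OrthoB.q1 : OrthoB.Generic1) (e : OrthoB.Generic1) k
        (OrthoB.triSum (fun lam mu => OrthoB.specialize k e he (u lam mu)) lam)
        (OrthoB.triSum (fun lam mu => OrthoB.specialize k e he (u lam mu)) mu)) := by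
    intro lam mu
    rw [OrthoB.map_pair, OrthoB.baseChange_triSum, OrthoB.baseChange_triSum, OrthoB.evalAt_q1,
      map_intCast]
    rfl
  have horth : ∀ lam mu, lam ≠ mu → OrthoB.pair q (e : K) k
      (OrthoB.triSum (fun lam mu => φ (u lam mu)) lam)
      (OrthoB.triSum (fun lam mu => φ (u lam mu)) mu) = 0 := fun lam mu h => by
    rw [hpair, (hu k e he).1 lam mu h, map_zero]
  have hnorm : ∀ lam, OrthoB.pair q (e : K) k
      (OrthoB.triSum (fun lam mu => φ (u lam mu)) lam)
      (OrthoB.triSum (fun lam mu => φ (u lam mu)) lam) ≠ 0 := fun lam => by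
    rw [hpair]
    exact (((hu k e he).2 lam).map θ).ne_zero
  refine ⟨fun lam mu _ => hden lam mu, OrthoB.triSum fun lam mu => φ (u lam mu), fun lam => ?_,
    OrthoB.linearIndependent_triSum q (e : K) k _ horth hnorm, OrthoB.span_triSum _, horth,
    fun G c v hc hG hGorth lam => ⟨c lam, hc lam, OrthoB.eq_smul_triSum q (e : K) k _ horth hnorm
      hc hG hGorth lam⟩⟩
  simp only [hdiv]
  rfl
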